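/- A parameterized problem over a finite alphabet $\Sigma$ is a set $L\subseteq\Sigma^*\times\mathbb{N}$. It belongs to the class W[P] if there are a computable function $f:\mathbb{N}\to\mathbb{N}$, a polynomial $p$ and a nondeterministic Turing machine that decides, for all $(x,k)\in\Sigma^*\times\mathbb{N}$, whether $(x,k)\in L$, such that every computation on $(x,k)$ has at most $f(k)\,p(|x|)$ steps, of which at most $f(k)\,\lfloor\log_2|x|\rfloor$ are nondeterministic (read $\lfloor\log_2|x|\rfloor$ as $0$ when $|x|=0$). Max Lin AA is the following parameterized problem. An instance consists of a system $Az=b$ of $m$ linear equations in $n$ variables over $\mathbb{F}_2$, in which every equation contains at least one variable (no row of $A$ is zero) and has a positive integral weight (written in binary), together with a parameter $k\in\mathbb{N}$. The excess of an assignment $z\in\mathbb{F}_2^n$ is the total weight of the equations satisfied by $z$ minus the total weight of the equations falsified by $z$. The question is whether the maximum excess over all assignments is at least $k$. Theorem. Max Lin AA is in the parameterized complexity class W[P]. -/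

import Mathlib

/-! ## Nondeterministic Turing machines with resource bounds -/

/-- A nondeterministic Turing machine with input alphabet `I`, given by two transition functions
`tr false` and `tr true`; in every step one of the two is applied.  The underlying deterministic
model is the multi-tape model `Turing.TM2` on which Mathlib's time-bounded computation
(`Turing.FinTM2`) is based: finitely many tapes used as stacks, a finite set of labels (control
states) and a finite internal memory. -/
structure NTM (I : Type) where
  /-- index set of the tapes -/
  K : Type
  [decK : DecidableEq K]
  [finK : Fintype K]
  /-- tape alphabets -/
  Γ : K → Type
  [finΓ : ∀ k, Fintype (Γ k)]
  /-- control states -/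
  Λ : Type
  [finΛ : Fintype Λ]
  /-- internal memory -/
  σ : Type
  [finσ : Fintype σ]
  /-- the tape holding the input -/
  inputTape : K
  /-- input letters are letters of the input tape -/
  letter : I ↪ Γ inputTape
  /-- initial control state -/
  main : Λ
  /-- initial internal memory -/
  init : σ
  /-- a halted computation is accepting if its internal memory satisfies `accept` -/
  accept : σ → Bool
  /-- the two transition functions -/
  tr : Bool → Λ → Turing.TM2.Stmt Γ Λ σ

namespace NTM

variable {I : Type}

attribute [instance] NTM.decK NTM.finK NTM.finΓ NTM.finΛ NTM.finσ

/-- Configurations: control state (`none` if halted), internal memory, tape contents. -/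
abbrev Cfg (M : NTM I) : Type := Turing.TM2.Cfg M.Γ M.Λ M.σ

/-- One step with the transition function `tr b`; the value is `none` iff `c` is halted. -/
def step (M : NTM I) (b : Bool) (c : M.Cfg) : Option M.Cfg := Turing.TM2.step (M.tr b) c

/-- The initial configuration on the input word `u`: the first letter of `u` is on top of the
input tape and all other tapes are empty. -/
def initCfg (M : NTM I) (u : List I) : M.Cfg where
  l := some M.main
  var := M.init
  stk := Function.update (fun _ => []) M.inputTape (u.map M.letter)

/-- `M.Run c t s d`: some partial computation of `M` leads from `c` to `d` in `t` steps, of which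
exactly `s` are nondeterministic, i.e. start in a configuration with two distinct successors. -/
inductive Run (M : NTM I) (c : M.Cfg) : ℕ → ℕ → M.Cfg → Prop
  | refl : Run M c 0 0 c
  | det {t s : ℕ} {d e : M.Cfg} (h : Run M c t s d)
      (h₀ : M.step false d = some e) (h₁ : M.step true d = some e) : Run M c (t + 1) s e
  | nondet {t s : ℕ} {d e : M.Cfg} (b : Bool) (h : Run M c t s d)
      (hne : M.step false d ≠ M.step true d) (hb : M.step b d = some e) :
      Run M c (t + 1) (s + 1) e

/-- `M` accepts `u` if some computation on `u` halts in an accepting configuration. -/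
def Accepts (M : NTM I) (u : List I) : Prop :=
  ∃ (t s : ℕ) (d : M.Cfg), M.Run (M.initCfg u) t s d ∧ d.l = none ∧ M.accept d.var = true

/-- Every computation of `M` on `u` makes at most `T` steps (so it halts), at most `S` of which are
nondeterministic. -/
def Bounded (M : NTM I) (u : List I) (T S : ℕ) : Prop :=
  ∀ (t s : ℕ) (d : M.Cfg), M.Run (M.initCfg u) t s d → t ≤ T ∧ s ≤ S

end NTM

/-! ## Parameterized problems and the class W[P] -/

/-- A parameterized problem over the alphabet `A` is a subset of `A* × ℕ`. -/
abbrev ParamProblem (A : Type) : Type := Set (List A × ℕ)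

/-- The input word that presents the instance `(x, k)` to a machine: the word `x` followed by `k`
copies of a new letter.  (Any other presentation of `k` defines the same class, as the time bound
may depend on `k` by an arbitrary computable factor.) -/
def paramInput {A : Type} (x : List A) (k : ℕ) : List (Option A) :=
  x.map some ++ List.replicate k none

/-- `L` is in W[P]: some nondeterministic Turing machine decides `(x, k) ∈ L` in at most
`f(k) · p(|x|)` steps, at most `f(k) · ⌊log₂ |x|⌋` of which are nondeterministic, for a computable
function `f` and a polynomial `p`. -/
def InWP {A : Type} (L : ParamProblem A) : Prop :=
  ∃ (M : NTM (Option A)) (f : ℕ → ℕ) (p : Polynomial ℕ), Computable f ∧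
    ∀ (x : List A) (k : ℕ),
      M.Bounded (paramInput x k) (f k * p.eval x.length) (f k * Nat.log 2 x.length) ∧
      (M.Accepts (paramInput x k) ↔ (x, k) ∈ L)

/-! ## Max Lin AA -/

/-- A weighted system `A z = b` of `m` linear equations in `n` variables over `𝔽₂`.  The weights are
positive integers and every equation contains at least one variable. -/
structure MaxLinSystem where
  n : ℕ
  m : ℕ
  A : Matrix (Fin m) (Fin n) (ZMod 2)
  b : Fin m → ZMod 2
  w : Fin m → ℕ
  w_pos : ∀ j, 0 < w j
  row_ne_zero : ∀ j, A j ≠ 0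

/-- The letters used to write down systems. -/
inductive SysLetter
  | zero
  | one
  | sep
  deriving DecidableEq

instance : Fintype SysLetter where
  elems := {.zero, .one, .sep}
  complete := by rintro (_ | _ | _) <;> simp

namespace MaxLinSystem

/-- The excess of an assignment: the total weight of satisfied equations minus the total weight of
falsified equations. -/
def excess (S : MaxLinSystem) (z : Fin S.n → ZMod 2) : ℤ :=
  (∑ j with S.A.mulVec z j = S.b j, (S.w j : ℤ)) - ∑ j with S.A.mulVec z j ≠ S.b j, (S.w j : ℤ)

/-- The maximum excess over all assignments. -/
def maxExcess (S : MaxLinSystem) : ℤ :=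
  Finset.univ.sup' Finset.univ_nonempty S.excess

/-- The letter for an element of `𝔽₂`. -/
def coeffLetter (a : ZMod 2) : SysLetter := if a = 0 then .zero else .one

/-- The letter for a binary digit. -/
def bitLetter (a : Bool) : SysLetter := if a then .one else .zero

/-- The equation number `j`: its `n` coefficients, its right-hand side, its weight in binary
(least significant digit first), and a separator. -/
def encodeEq (S : MaxLinSystem) (j : Fin S.m) : List SysLetter :=
  List.ofFn (fun i => coeffLetter (S.A j i)) ++
    coeffLetter (S.b j) :: ((Nat.bits (S.w j)).map bitLetter ++ [.sep])

/-- The word for a system: `n` in unary, a separator, and the equations one after the other. -/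
def encode (S : MaxLinSystem) : List SysLetter :=
  List.replicate S.n .one ++ .sep :: (List.ofFn S.encodeEq).flatten

end MaxLinSystem

/-- Max Lin AA parameterized by `k`: given a system, is its maximum excess at least `k`? -/
def MaxLinAA : ParamProblem SysLetter :=
  {q | ∃ S : MaxLinSystem, q.1 = S.encode ∧ (q.2 : ℤ) ≤ S.maxExcess}

/-! ## Paths of a nondeterministic machine -/

/-- `ChoicePath step c l t d`: the machine runs from `c` to `d` in `t` steps, where `l` lists the choices
made in those steps that start in a configuration with two distinct successors. -/
inductive ChoicePath {C : Type} (step : Bool → C → Option C) : C → List Bool → ℕ → C → Prop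
  | refl (c : C) : ChoicePath step c [] 0 c
  | det {c d e : C} {l : List Bool} {t : ℕ} (h₀ : step false c = some d)
      (h₁ : step true c = some d) (h : ChoicePath step d l t e) : ChoicePath step c l (t + 1) e
  | nondet {c d e : C} {l : List Bool} {t : ℕ} (b : Bool) (hne : step false c ≠ step true c)
      (hb : step b c = some d) (h : ChoicePath step d l t e) : ChoicePath step c (b :: l) (t + 1) e

namespace ChoicePath

variable {C : Type} {step : Bool → C → Option C}

theorem trans {c d e : C} {l l' : List Bool} {t t' : ℕ} (h : ChoicePath step c l t d)
    (h' : ChoicePath step d l' t' e) : ChoicePath step c (l ++ l') (t + t') e := by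
  induction h with
  | refl => simpa using h'
  | det h₀ h₁ _ ih => rw [Nat.add_right_comm]; exact .det h₀ h₁ (ih h')
  | nondet b hne hb _ ih => rw [Nat.add_right_comm]; exact .nondet b hne hb (ih h')

/-- A path whose choices are compatible with those of a halting path is an initial part of it. -/
theorem le_of_halting {c d e : C} {l l' : List Bool} {t t' : ℕ} (h : ChoicePath step c l t d)
    (h' : ChoicePath step c l' t' e) (he : ∀ b, step b e = none) (hl : l <+: l' ∨ l' <+: l) :
    t ≤ t' ∧ l.length ≤ l'.length ∧ ((∀ b, step b d = none) → d = e) := by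
  induction h generalizing l' t' with
  | refl c =>
    refine ⟨Nat.zero_le _, Nat.zero_le _, fun hc => ?_⟩
    cases h' with
    | refl => rfl
    | det h₀ => simp [hc] at h₀
    | nondet b _ hb => simp [hc] at hb
  | det h₀ h₁ _ ih =>
    cases h' with
    | refl => simp [he] at h₀
    | det h₀' _ h'' =>
      rw [h₀] at h₀'
      cases h₀'
      obtain ⟨h1, h2, h3⟩ := ih h'' hl
      exact ⟨by omega, h2, h3⟩
    | nondet b hne _ _ => exact absurd (h₀.trans h₁.symm) hne
  | nondet b hne hb _ ih =>
    cases h' with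
    | refl => simp [he] at hb
    | det h₀' h₁' _ => exact absurd (h₀'.trans h₁'.symm) hne
    | nondet b' _ hb' h'' =>
      have hbb : b = b' := by
        rcases hl with hl | hl <;> simp [List.cons_prefix_cons] at hl <;> simp [hl.1]
      subst hbb
      rw [hb] at hb'
      cases hb'
      obtain ⟨h1, h2, h3⟩ := ih h'' (by simpa [List.cons_prefix_cons] using hl)
      exact ⟨by omega, by simpa using h2, h3⟩

end ChoicePath

namespace NTM

variable {I : Type} {M : NTM I}

theorem Run.exists_path {c d : M.Cfg} {t s : ℕ} (h : M.Run c t s d) :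
    ∃ l : List Bool, l.length = s ∧ ChoicePath M.step c l t d := by
  induction h with
  | refl => exact ⟨[], rfl, .refl _⟩
  | det _ h₀ h₁ ih =>
    obtain ⟨l, hl, hp⟩ := ih
    exact ⟨l, hl, by simpa using hp.trans (.det h₀ h₁ (.refl _))⟩
  | nondet b _ hne hb ih =>
    obtain ⟨l, hl, hp⟩ := ih
    exact ⟨l ++ [b], by simp [hl], by simpa using hp.trans (.nondet b hne hb (.refl _))⟩

theorem Run.append_path {c₀ c d : M.Cfg} {t₀ s₀ t : ℕ} {l : List Bool} (h : M.Run c₀ t₀ s₀ c)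
    (hp : ChoicePath M.step c l t d) : M.Run c₀ (t₀ + t) (s₀ + l.length) d := by
  induction hp generalizing t₀ s₀ with
  | refl => simpa using h
  | det h₀ h₁ _ ih =>
    have := ih (h.det h₀ h₁)
    rwa [Nat.add_right_comm, Nat.add_assoc] at this
  | nondet b hne hb _ ih =>
    have := ih (h.nondet b hne hb)
    rwa [Nat.add_assoc, Nat.add_assoc, Nat.add_comm 1, Nat.add_comm 1] at this

theorem step_eq_none {b : Bool} {c : M.Cfg} (h : c.l = none) : M.step b c = none := by
  obtain ⟨l, v, S⟩ := c
  cases h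
  rfl

/-- If every sequence of `N` choices leads to a halted configuration within `T` steps, these are
all the computations of the machine. -/
theorem bounded_and_accepts_iff {u : List I} {T N : ℕ} (fin : List Bool → M.Cfg)
    (hfin : ∀ l, (fin l).l = none)
    (h : ∀ l : List Bool, l.length = N → ∃ t ≤ T, ChoicePath M.step (M.initCfg u) l t (fin l)) :
    M.Bounded u T N ∧
      (M.Accepts u ↔ ∃ l : List Bool, l.length = N ∧ M.accept (fin l).var = true) := by
  have key : ∀ {t s d}, M.Run (M.initCfg u) t s d →
      ∃ l : List Bool, l.length = N ∧ t ≤ T ∧ s ≤ N ∧ (d.l = none → d = fin l) := by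
    intro t s d hr
    obtain ⟨l, hl, hp⟩ := hr.exists_path
    obtain ⟨l', hl', hc⟩ : ∃ l' : List Bool, l'.length = N ∧ (l <+: l' ∨ l' <+: l) := by
      rcases le_total l.length N with hle | hle
      · exact ⟨l ++ List.replicate (N - l.length) false, by simp [hle], .inl (by simp)⟩
      · exact ⟨l.take N, by simpa using hle, .inr (List.take_prefix _ _)⟩
    obtain ⟨t', ht', hp'⟩ := h l' hl'
    obtain ⟨h1, h2, h3⟩ := hp.le_of_halting hp' (fun b => step_eq_none (hfin _)) hc
    exact ⟨l', hl', h1.trans ht', by omega, fun hd => h3 fun b => step_eq_none hd⟩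
  refine ⟨fun t s d hr => ?_, ?_, ?_⟩
  · obtain ⟨_, _, h1, h2, _⟩ := key hr
    exact ⟨h1, h2⟩
  · rintro ⟨t, s, d, hr, hd, ha⟩
    obtain ⟨l, hl, _, _, h3⟩ := key hr
    exact ⟨l, hl, h3 hd ▸ ha⟩
  · rintro ⟨l, hl, ha⟩
    obtain ⟨t, _, hp⟩ := h l hl
    exact ⟨_, _, _, Run.append_path .refl hp, hfin l, ha⟩

end NTM

/-! ## A structured programming language for stack machines -/

namespace LinAA

/-- Tape letters: the letters of systems, the letter that presents the parameter, and two letters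
that mark the equations which may still be selected and those which may not. -/
inductive Sym
  | zero | one | sep | tick | live | dead
  deriving DecidableEq

instance : Fintype Sym where
  elems := {.zero, .one, .sep, .tick, .live, .dead}
  complete := by rintro (_ | _) <;> simp

/-- The tapes. -/
inductive Tape
  | I | E | F | X | R | R' | C₀ | C₁ | U | W | L | L' | B | G | K | P | N
  deriving DecidableEq

instance : Fintype Tape where
  elems := {.I, .E, .F, .X, .R, .R', .C₀, .C₁, .U, .W, .L, .L', .B, .G, .K, .P, .N}
  complete := by rintro (_ | _) <;> simp

/-- Phases of reading the input. -/
inductive Phase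
  | header | start | row | weight | bad
  deriving DecidableEq

instance : Fintype Phase where
  elems := {.header, .start, .row, .weight, .bad}
  complete := by rintro (_ | _) <;> simp

/-- The internal memory. -/
structure Reg where
  c : Option Sym := none
  c' : Option Sym := none
  phase : Phase := .header
  swapped : Bool := false
  nz : Bool := false
  last : Bool := false
  par : Bool := false
  bit : Bool := false
  found : Bool := false
  copying : Bool := false
  rhs : Bool := false
  piv : Bool := false
  cur : Bool := false
  carry : Bool := false
  ge : Bool := true

instance : Finite Reg :=
  Finite.of_injective
    (fun v : Reg => ((v.c, v.c', v.phase, v.swapped, v.nz), (v.last, v.par, v.bit, v.found),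
      (v.copying, v.rhs, v.piv), v.cur, v.carry, v.ge)) (by
    rintro ⟨⟩ ⟨⟩ h
    simpa [and_assoc] using h)

/-- The internal memory together with the contents of the tapes. -/
structure St where
  v : Reg := {}
  I : List Sym := []
  E : List Sym := []
  F : List Sym := []
  X : List Sym := []
  R : List Sym := []
  R' : List Sym := []
  C₀ : List Sym := []
  C₁ : List Sym := []
  U : List Sym := []
  W : List Sym := []
  L : List Sym := []
  L' : List Sym := []
  B : List Sym := []
  G : List Sym := []
  K : List Sym := []
  P : List Sym := []
  N : List Sym := []

namespace St

/-- The contents of a tape. -/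
def get (s : St) : Tape → List Sym
  | .I => s.I | .E => s.E | .F => s.F | .X => s.X | .R => s.R | .R' => s.R' | .C₀ => s.C₀
  | .C₁ => s.C₁ | .U => s.U | .W => s.W | .L => s.L | .L' => s.L' | .B => s.B | .G => s.G
  | .K => s.K | .P => s.P | .N => s.N

/-- Replace the contents of a tape. -/
def set (s : St) (k : Tape) (x : List Sym) : St :=
  match k with
  | .I => { s with I := x } | .E => { s with E := x } | .F => { s with F := x }
  | .X => { s with X := x } | .R => { s with R := x } | .R' => { s with R' := x }
  | .C₀ => { s with C₀ := x } | .C₁ => { s with C₁ := x } | .U => { s with U := x }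
  | .W => { s with W := x } | .L => { s with L := x } | .L' => { s with L' := x }
  | .B => { s with B := x } | .G => { s with G := x } | .K => { s with K := x }
  | .P => { s with P := x } | .N => { s with N := x }

theorem get_set (s : St) (k : Tape) (x : List Sym) :
    (s.set k x).get = Function.update s.get k x := by
  funext k'
  cases k <;> cases k' <;> rfl

@[simp] theorem set_v (s : St) (k : Tape) (x : List Sym) : (s.set k x).v = s.v := by
  cases k <;> rfl

/-- Replace the internal memory. -/
def setV (s : St) (v : Reg) : St := { s with v := v }

@[simp] theorem setV_v (s : St) (v : Reg) : (s.setV v).v = v := rfl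

@[simp] theorem setV_setV (s : St) (v w : Reg) : (s.setV v).setV w = s.setV w := rfl

@[simp] theorem get_setV (s : St) (v : Reg) : (s.setV v).get = s.get := by
  funext k; cases k <;> rfl

end St

/-- Straight-line code, executed in a single step of the machine. -/
inductive Op
  | nop
  | push (k : Tape) (f : Reg → Sym)
  | pop (k : Tape) (f : Reg → Option Sym → Reg)
  | load (f : Reg → Reg)
  | seq (a b : Op)
  | ite (c : Reg → Bool) (a b : Op)

namespace Op

/-- The effect of straight-line code. -/
@[simp] def run : Op → St → St
  | nop, s => s
  | push k f, s => s.set k (f s.v :: s.get k)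
  | pop k f, s => (s.set k (s.get k).tail).setV (f s.v (s.get k).head?)
  | load f, s => s.setV (f s.v)
  | seq a b, s => b.run (a.run s)
  | ite c a b, s => cond (c s.v) (a.run s) (b.run s)

/-- Machine statements. -/
abbrev Stm (Λ : Type) : Type := Turing.TM2.Stmt (fun _ : Tape => Sym) Λ Reg

/-- The machine statement that executes straight-line code before the statement `q`. -/
def stmt {Λ : Type} : Op → Stm Λ → Stm Λ
  | nop, q => q
  | push k f, q => .push k f q
  | pop k f, q => .pop k f q
  | load f, q => .load f q
  | seq a b, q => a.stmt (b.stmt q)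
  | ite c a b, q => .branch c (a.stmt q) (b.stmt q)

theorem stepAux_stmt {Λ : Type} (o : Op) (q : Stm Λ) (s : St) :
    Turing.TM2.stepAux (o.stmt q) s.v s.get = Turing.TM2.stepAux q (o.run s).v (o.run s).get := by
  induction o generalizing q s with
  | nop => rfl
  | push k f => simp [stmt, St.get_set]
  | pop k f => simp [stmt, St.get_set]
  | load f => simp [stmt]
  | seq a b iha ihb => simp [stmt, iha, ihb]
  | ite c a b iha ihb =>
    simp only [stmt, Turing.TM2.stepAux, run]
    cases c s.v <;> simp [iha, ihb]

end Op

/-- Structured programs.  `loop o c p` executes `o`, tests `c`, and stops or executes `p` and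
starts again; `flip` loads a nondeterministically chosen bit. -/
inductive Prog
  | op (o : Op)
  | flip
  | seq (p q : Prog)
  | ite (c : Reg → Bool) (p q : Prog)
  | loop (o : Op) (c : Reg → Bool) (p : Prog)

/-- Sequential composition. -/
infixr:60 " ;; " => Prog.seq

/-- `Exec p s l t s'`: started in `s`, the program `p` ends in `s'` after at most `t` steps, if `l`
is the list of nondeterministically chosen bits. -/
inductive Exec : Prog → St → List Bool → ℕ → St → Prop
  | op (o : Op) (s : St) : Exec (.op o) s [] 1 (o.run s)
  | flip (b : Bool) (s : St) : Exec .flip s [b] 1 (s.setV { s.v with bit := b })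
  | seq {p q : Prog} {s s' s'' : St} {l l' : List Bool} {t t' : ℕ} (hp : Exec p s l t s')
      (hq : Exec q s' l' t' s'') : Exec (.seq p q) s (l ++ l') (t + t') s''
  | ite_true {c : Reg → Bool} {p q : Prog} {s s' : St} {l : List Bool} {t : ℕ}
      (hc : c s.v = true) (hp : Exec p s l t s') : Exec (.ite c p q) s l (t + 1) s'
  | ite_false {c : Reg → Bool} {p q : Prog} {s s' : St} {l : List Bool} {t : ℕ}
      (hc : c s.v = false) (hq : Exec q s l t s') : Exec (.ite c p q) s l (t + 1) s'
  | loop_done {o : Op} {c : Reg → Bool} {p : Prog} {s : St} (hc : c (o.run s).v = false) :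
      Exec (.loop o c p) s [] 1 (o.run s)
  | loop_step {o : Op} {c : Reg → Bool} {p : Prog} {s s' s'' : St} {l l' : List Bool} {t t' : ℕ}
      (hc : c (o.run s).v = true) (hp : Exec p (o.run s) l t s')
      (hl : Exec (.loop o c p) s' l' t' s'') : Exec (.loop o c p) s (l ++ l') (t + 1 + t') s''
  | mono {p : Prog} {s s' : St} {l : List Bool} {t t' : ℕ} (h : Exec p s l t s') (ht : t ≤ t') :
      Exec p s l t' s'

namespace Prog

/-- The control states of a program. -/
def Lbl : Prog → Type
  | op _ => Unit
  | flip => Unit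
  | seq p q => p.Lbl ⊕ q.Lbl
  | ite _ p q => Option (p.Lbl ⊕ q.Lbl)
  | loop _ _ p => Option p.Lbl

theorem finite_lbl : ∀ p : Prog, Finite p.Lbl
  | op _ => inferInstanceAs (Finite Unit)
  | flip => inferInstanceAs (Finite Unit)
  | seq p q =>
    have := p.finite_lbl
    have := q.finite_lbl
    inferInstanceAs (Finite (p.Lbl ⊕ q.Lbl))
  | ite _ p q =>
    have := p.finite_lbl
    have := q.finite_lbl
    inferInstanceAs (Finite (Option (p.Lbl ⊕ q.Lbl)))
  | loop _ _ p =>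
    have := p.finite_lbl
    inferInstanceAs (Finite (Option p.Lbl))

/-- The first control state. -/
def entry : ∀ p : Prog, p.Lbl
  | op _ => ()
  | flip => ()
  | seq p _ => .inl p.entry
  | ite _ _ _ => none
  | loop _ _ _ => none

/-- The machine code of a program, as part of a machine with control states `Λ`. -/
def code {Λ : Type} : ∀ p : Prog, (p.Lbl → Λ) → Λ → Bool → p.Lbl → Op.Stm Λ
  | op o, _, exit, _, _ => o.stmt (.goto fun _ => exit)
  | flip, _, exit, b, _ => .load (fun v => { v with bit := b }) (.goto fun _ => exit)
  | seq p q, emb, exit, b, x =>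
    match x with
    | .inl y => p.code (fun z => emb (.inl z)) (emb (.inr q.entry)) b y
    | .inr y => q.code (fun z => emb (.inr z)) exit b y
  | ite c p q, emb, exit, b, x =>
    match x with
    | none => .branch c (.goto fun _ => emb (some (.inl p.entry)))
        (.goto fun _ => emb (some (.inr q.entry)))
    | some (.inl y) => p.code (fun z => emb (some (.inl z))) exit b y
    | some (.inr y) => q.code (fun z => emb (some (.inr z))) exit b y
  | loop o c p, emb, exit, b, x =>
    match x with
    | none => o.stmt (.branch c (.goto fun _ => emb (some p.entry)) (.goto fun _ => exit))
    | some y => p.code (fun z => emb (some z)) (emb none) b y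

end Prog

open Turing in
/-- The machine code of a program does what the program does. -/
theorem Exec.path {Λ : Type} {tr : Bool → Λ → Op.Stm Λ} {p : Prog} {s s' : St} {l : List Bool}
    {t : ℕ} (h : Exec p s l t s') (emb : p.Lbl → Λ) (exit : Λ)
    (htr : ∀ b x, tr b (emb x) = p.code emb exit b x) :
    ∃ t' ≤ t, ChoicePath (fun b => TM2.step (tr b)) ⟨some (emb p.entry), s.v, s.get⟩ l t'
      ⟨some exit, s'.v, s'.get⟩ := by
  induction h generalizing exit with
  | op o s =>
    have : ∀ b, TM2.step (tr b) ⟨some (emb (Prog.op o).entry), s.v, s.get⟩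
        = some ⟨some exit, (o.run s).v, (o.run s).get⟩ := fun b => by
      simp [TM2.step, htr, Prog.code, Op.stepAux_stmt]
    exact ⟨1, le_rfl, .det (this _) (this _) (.refl _)⟩
  | flip b s =>
    have : ∀ b, TM2.step (tr b) ⟨some (emb Prog.flip.entry), s.v, s.get⟩
        = some ⟨some exit, { s.v with bit := b }, s.get⟩ := fun b => by
      simp [TM2.step, htr, Prog.code]
    refine ⟨1, le_rfl, .nondet b (by simp [this]) (this b) ?_⟩
    rw [St.get_setV]
    exact .refl _
  | @seq p q _ _ _ _ _ _ _ _ _ ihp ihq =>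
    obtain ⟨t₁, h₁, hp⟩ := ihp (fun z => emb (.inl z)) (emb (.inr q.entry))
      (fun b x => htr b (.inl x))
    obtain ⟨t₂, h₂, hq⟩ := ihq (fun z => emb (.inr z)) exit (fun b x => htr b (.inr x))
    exact ⟨_, Nat.add_le_add h₁ h₂, hp.trans hq⟩
  | @ite_true c p q s _ _ _ hc _ ih =>
    obtain ⟨t₁, h₁, hp⟩ := ih (fun z => emb (some (.inl z))) exit
      (fun b x => htr b (some (.inl x)))
    have : ∀ b, TM2.step (tr b) ⟨some (emb (Prog.ite c p q).entry), s.v, s.get⟩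
        = some ⟨some (emb (some (.inl p.entry))), s.v, s.get⟩ := fun b => by
      have e := htr b none
      simp only [Prog.code] at e
      simp [TM2.step, Prog.entry, e, hc]
    exact ⟨_, Nat.succ_le_succ h₁, .det (this _) (this _) hp⟩
  | @ite_false c p q s _ _ _ hc _ ih =>
    obtain ⟨t₁, h₁, hp⟩ := ih (fun z => emb (some (.inr z))) exit
      (fun b x => htr b (some (.inr x)))
    have : ∀ b, TM2.step (tr b) ⟨some (emb (Prog.ite c p q).entry), s.v, s.get⟩
        = some ⟨some (emb (some (.inr q.entry))), s.v, s.get⟩ := fun b => by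
      have e := htr b none
      simp only [Prog.code] at e
      simp [TM2.step, Prog.entry, e, hc]
    exact ⟨_, Nat.succ_le_succ h₁, .det (this _) (this _) hp⟩
  | @loop_done o c p s hc =>
    have : ∀ b, TM2.step (tr b) ⟨some (emb (Prog.loop o c p).entry), s.v, s.get⟩
        = some ⟨some exit, (o.run s).v, (o.run s).get⟩ := fun b => by
      have e := htr b none
      simp only [Prog.code] at e
      simp [TM2.step, Prog.entry, e, Op.stepAux_stmt, hc]
    exact ⟨1, le_rfl, .det (this _) (this _) (.refl _)⟩
  | @loop_step o c p s s' _ _ _ _ _ hc _ _ ihp ihl =>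
    obtain ⟨t₁, h₁, hp⟩ := ihp (fun z => emb (some z)) (emb none) (fun b x => htr b (some x))
    obtain ⟨t₂, h₂, hl⟩ := ihl emb exit htr
    have : ∀ b, TM2.step (tr b) ⟨some (emb (Prog.loop o c p).entry), s.v, s.get⟩
        = some ⟨some (emb (some p.entry)), (o.run s).v, (o.run s).get⟩ := fun b => by
      have e := htr b none
      simp only [Prog.code] at e
      simp [TM2.step, Prog.entry, e, Op.stepAux_stmt, hc]
    exact ⟨_, Nat.add_le_add (Nat.succ_le_succ h₁) h₂, (ChoicePath.det (this _) (this _) hp).trans hl⟩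
  | mono _ ht ih =>
    obtain ⟨t₁, h₁, hp⟩ := ih emb exit htr
    exact ⟨t₁, h₁.trans ht, hp⟩

/-- The tape letter for a letter of the input. -/
def inputSym : Option SysLetter → Sym
  | some .zero => .zero
  | some .one => .one
  | some .sep => .sep
  | none => .tick

/-- The machine that executes a program and accepts if the program ends with `accept`. -/
noncomputable def machine (p : Prog) (accept : Reg → Bool) : NTM (Option SysLetter) where
  K := Tape
  Γ := fun _ => Sym
  finΓ := fun _ => inferInstance
  Λ := Option p.Lbl
  finΛ := @Fintype.ofFinite _ (@instFiniteOption _ p.finite_lbl)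
  σ := Reg
  finσ := Fintype.ofFinite Reg
  inputTape := .I
  letter := ⟨inputSym, by rintro (_ | _ | _ | _) (_ | _ | _ | _) <;> simp [inputSym]⟩
  main := some p.entry
  init := {}
  accept := accept
  tr := fun b l =>
    match l with
    | none => .halt
    | some x => p.code some none b x

theorem machine_bounded_and_accepts_iff {p : Prog} {accept : Reg → Bool}
    {u : List (Option SysLetter)} {T N : ℕ} (fin : List Bool → St)
    (h : ∀ l : List Bool, l.length = N → Exec p { I := u.map inputSym } l T (fin l)) :
    (machine p accept).Bounded u (T + 1) N ∧
      ((machine p accept).Accepts u ↔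
        ∃ l : List Bool, l.length = N ∧ accept (fin l).v = true) := by
  refine NTM.bounded_and_accepts_iff (M := machine p accept)
    (fun l => ⟨none, (fin l).v, (fin l).get⟩) (fun l => rfl) fun l hl => ?_
  obtain ⟨t, ht, hp⟩ := (h l hl).path (tr := (machine p accept).tr) some none (fun b x => rfl)
  have hinit : (machine p accept).initCfg u
      = ⟨some (some p.entry), ({ I := u.map inputSym } : St).v,
          ({ I := u.map inputSym } : St).get⟩ := by
    have : Function.update (fun _ => []) Tape.I (u.map inputSym)
        = ({ I := u.map inputSym } : St).get := by
      funext k; cases k <;> rfl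
    rw [← this]
    rfl
  rw [hinit]
  refine ⟨t + 1, by omega, ?_⟩
  have := ChoicePath.trans (step := (machine p accept).step) hp
    (.det (d := ⟨none, (fin l).v, (fin l).get⟩) rfl rfl (.refl _))
  rw [List.append_nil] at this
  exact this

end LinAA

/-! ## Elimination in weighted systems of linear equations over `𝔽₂` -/

namespace LinAA

/-- A weighted linear equation over `𝔽₂`. -/
structure Eqn where
  row : List Bool
  rhs : Bool
  wt : ℕ

/-- The value of a linear form. -/
def dot : List Bool → (ℕ → Bool) → Bool
  | [], _ => false
  | a :: r, z => (a && z 0) ^^ dot r (fun i => z (i + 1))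

/-- Prepend a value to an assignment. -/
def consAssign (a : Bool) (z : ℕ → Bool) : ℕ → Bool
  | 0 => a
  | i + 1 => z i

theorem dot_consAssign (a b : Bool) (r : List Bool) (z : ℕ → Bool) :
    dot (a :: r) (consAssign b z) = ((a && b) ^^ dot r z) := rfl

/-- The entry of the second row at the position of the first `true` of the first row. -/
def pivBit : List Bool → List Bool → Bool
  | true :: _, b :: _ => b
  | false :: R, _ :: r => pivBit R r
  | _, _ => false

theorem dot_zipWith (r R : List Bool) (h : r.length = R.length) (z : ℕ → Bool) :
    dot (List.zipWith xor r R) z = (dot r z ^^ dot R z) := by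
  induction r generalizing R z with
  | nil => cases R <;> simp_all [dot]
  | cons a r ih =>
    obtain _ | ⟨b, R⟩ := R
    · simp at h
    · simp only [List.zipWith_cons_cons, dot, ih R (by simpa using h)]
      cases a <;> cases b <;> cases z 0 <;> simp

theorem pivBit_zipWith (R r : List Bool) (h : r.length = R.length) :
    pivBit R (List.zipWith xor r R) = (pivBit R r ^^ pivBit R R) := by
  induction R generalizing r with
  | nil => simp [pivBit]
  | cons b R ih =>
    obtain _ | ⟨a, r⟩ := r
    · simp at h
    · cases b
      · simpa [pivBit] using ih r (by simpa using h)
      · simp [pivBit]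

theorem pivBit_self (R : List Bool) : pivBit R R = decide (true ∈ R) := by
  induction R with
  | nil => simp [pivBit]
  | cons b R ih => cases b <;> simp [pivBit, ih]

theorem pivBit_eq_false {R : List Bool} (h : true ∉ R) (r : List Bool) : pivBit R r = false := by
  induction R generalizing r with
  | nil => simp [pivBit]
  | cons b R ih =>
    cases b
    · cases r with
      | nil => simp [pivBit]
      | cons a r => simpa [pivBit] using ih (by simpa using h) r
    · simp at h

theorem mem_of_pivBit {R r : List Bool} (h : pivBit R r = true) : true ∈ r := by
  induction R generalizing r with
  | nil => simp [pivBit] at h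
  | cons b R ih =>
    obtain _ | ⟨a, r⟩ := r
    · cases b <;> simp [pivBit] at h
    · cases b
      · exact List.mem_cons_of_mem _ (ih (by simpa [pivBit] using h))
      · simp_all [pivBit]

theorem mem_zipWith_xor_iff (r R : List Bool) (h : r.length = R.length) :
    true ∈ List.zipWith xor r R ↔ r ≠ R := by
  induction r generalizing R with
  | nil => cases R <;> simp_all
  | cons a r ih =>
    obtain _ | ⟨b, R⟩ := R
    · simp at h
    · have := ih R (by simpa using h)
      simp only [List.zipWith_cons_cons, List.mem_cons, this]
      cases a <;> cases b <;> simp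

/-- The variable at the position of the first `true` of `R` can be adapted so that `R` takes a given
value. -/
theorem exists_dot_eq (R : List Bool) (hR : true ∈ R) (b : Bool) (z : ℕ → Bool) :
    ∃ z', dot R z' = b ∧
      ∀ r : List Bool, r.length = R.length → pivBit R r = false → dot r z' = dot r z := by
  induction R generalizing z with
  | nil => simp at hR
  | cons a R ih =>
    cases a
    · obtain ⟨z', h₁, h₂⟩ := ih (by simpa using hR) (fun i => z (i + 1))
      refine ⟨consAssign (z 0) z', by simpa [dot_consAssign] using h₁, fun r hr hp => ?_⟩
      obtain _ | ⟨c, r⟩ := r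
      · simp at hr
      · rw [dot_consAssign, dot, ← h₂ r (by simpa using hr) (by simpa [pivBit] using hp)]
    · refine ⟨consAssign (b ^^ dot R (fun i => z (i + 1))) (fun i => z (i + 1)), ?_,
        fun r hr hp => ?_⟩
      · simp [dot_consAssign]
      · obtain _ | ⟨c, r⟩ := r
        · simp at hr
        · obtain rfl : c = false := by simpa [pivBit] using hp
          simp [consAssign, dot]

namespace Eqn

/-- The contribution of an equation to the excess. -/
def val (e : Eqn) (z : ℕ → Bool) : ℤ := if dot e.row z = e.rhs then e.wt else -e.wt

/-- The contribution of an equation without variables to the excess. -/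
def const (e : Eqn) : ℤ := if true ∈ e.row then 0 else if e.rhs then -e.wt else e.wt

/-- Use the equation `e` to eliminate its first variable from `e'`. -/
def elim (e e' : Eqn) : Eqn :=
  if pivBit e.row e'.row then ⟨List.zipWith xor e'.row e.row, e'.rhs ^^ e.rhs, e'.wt⟩ else e'

/-- Substitute `a` for the first variable. -/
def subst (a : Bool) (e : Eqn) : Eqn := ⟨e.row.tail, e.rhs ^^ (e.row.headD false && a), e.wt⟩

theorem length_elim (e e' : Eqn) (h : e'.row.length = e.row.length) :
    (e.elim e').row.length = e'.row.length := by
  unfold elim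
  split <;> simp [h]

theorem val_elim {e e' : Eqn} (h : e'.row.length = e.row.length) {z : ℕ → Bool}
    (hz : dot e.row z = e.rhs) : (e.elim e').val z = e'.val z := by
  unfold elim
  split
  · simp [val, dot_zipWith _ _ h, hz]
  · rfl

theorem exists_val_eq (e : Eqn) (z : ℕ → Bool) :
    ∃ z', ∀ e' : Eqn, e'.row.length = e.row.length → (e.elim e').val z = e'.val z' := by
  by_cases he : true ∈ e.row
  · obtain ⟨z', h₁, h₂⟩ := exists_dot_eq e.row he e.rhs z
    refine ⟨z', fun e' h => ?_⟩
    rw [← val_elim h h₁, val, val, h₂]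
    · rw [length_elim _ _ h, h]
    · unfold elim
      split
      next hp => simp [pivBit_zipWith _ _ h, pivBit_self, he, hp]
      next hp => simpa using hp
  · refine ⟨z, fun e' _ => ?_⟩
    simp [elim, pivBit_eq_false he]

theorem const_elim {e e' : Eqn} (h : e'.row.length = e.row.length) {z : ℕ → Bool}
    (hz : dot e.row z = e.rhs) (he : true ∈ e.row) :
    (e.elim e').const = e'.const + if e'.row = e.row then e'.val z else 0 := by
  by_cases hr : e'.row = e.row
  · have h1 : pivBit e.row e'.row = true := by simp [hr, pivBit_self, he]
    have h2 := mem_zipWith_xor_iff e'.row e.row h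
    rw [elim, if_pos h1, const, if_neg (fun hm => h2.1 hm hr)]
    simp only [const, hr, he, val, hz, if_true, zero_add]
    cases e.rhs <;> cases e'.rhs <;> simp
  · simp only [hr, if_false, add_zero, elim]
    split
    next hp => simp [const, mem_zipWith_xor_iff _ _ h, hr, mem_of_pivBit hp]
    next => rfl

theorem val_subst (e : Eqn) (he : e.row ≠ []) (z : ℕ → Bool) :
    (e.subst (z 0)).val (fun i => z (i + 1)) = e.val z := by
  obtain ⟨_ | ⟨a, r⟩, b, w⟩ := e
  · simp at he
  · simp only [val, subst, dot, List.tail_cons, List.headD_cons]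
    have : (dot r (fun i => z (i + 1)) = (b ^^ (a && z 0))) ↔
        ((a && z 0) ^^ dot r (fun i => z (i + 1))) = b := by
      cases (a && z 0) <;> cases b <;> simp
    exact if_congr this rfl rfl

theorem const_subst (e : Eqn) (he : e.row ≠ []) :
    (e.subst false).const + (e.subst true).const = 2 * e.const := by
  obtain ⟨_ | ⟨a, r⟩, b, w⟩ := e
  · simp at he
  · by_cases hr : true ∈ r
    · simp [const, subst, hr]
    · cases a <;> cases b <;> simp [const, subst, hr] <;> ring

end Eqn

/-- The excess of an assignment. -/
def excess (l : List Eqn) (z : ℕ → Bool) : ℤ := (l.map fun e => e.val z).sum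

/-- The excess of the equations without variables. -/
def score (l : List Eqn) : ℤ := (l.map Eqn.const).sum

theorem exists_score_le_excess (n : ℕ) (l : List Eqn) (hl : ∀ e ∈ l, e.row.length = n) :
    ∃ z, score l ≤ excess l z := by
  induction n generalizing l with
  | zero =>
    refine ⟨fun _ => false, List.sum_le_sum fun e he => ?_⟩
    have : e.row = [] := List.length_eq_zero_iff.1 (hl e he)
    simp [Eqn.const, Eqn.val, this, dot]
    cases e.rhs <;> simp
  | succ n ih =>
    have hne : ∀ e ∈ l, e.row ≠ [] := fun e he h0 => by simpa [h0] using hl e he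
    have hsum : score (l.map (Eqn.subst false)) + score (l.map (Eqn.subst true))
        = 2 * score l := by
      simp only [score, List.map_map, ← List.sum_map_add, ← List.sum_map_mul_left]
      exact congrArg List.sum (List.map_congr_left fun e he => e.const_subst (hne e he))
    obtain ⟨a, ha⟩ : ∃ a, score l ≤ score (l.map (Eqn.subst a)) := by
      by_contra! h
      have h₁ := h false
      have h₂ := h true
      omega
    obtain ⟨z, hz⟩ := ih (l.map (Eqn.subst a)) (by
      intro e he
      obtain ⟨e', he', rfl⟩ := List.mem_map.1 he
      simp [Eqn.subst, hl e' he'])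
    refine ⟨consAssign a z, ha.trans (hz.trans_eq ?_)⟩
    simp only [excess, List.map_map]
    exact congrArg List.sum
      (List.map_congr_left fun e he => e.val_subst (hne e he) (consAssign a z))

/-- A sum that is positive has a class of equal rows with a positive sum. -/
theorem exists_row_class_pos (f : Eqn → ℤ) (l : List Eqn) (h : 0 < (l.map f).sum) :
    ∃ r, 0 < ((l.filter fun e => e.row = r).map f).sum := by
  induction hn : l.length using Nat.strong_induction_on generalizing l with
  | _ n ih =>
    obtain _ | ⟨e, l⟩ := l
    · simp at h
    by_contra! hc
    have hsplit := List.sum_map_filter_add_sum_map_filter_not (fun x : Eqn => x.row = e.row) f (e :: l)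
    have hlt : ((e :: l).filter fun x => ¬ x.row = e.row).length < n := by
      have := List.length_filter_le (fun x => ¬ x.row = e.row) l
      simp at this hn ⊢
      omega
    obtain ⟨r, hr⟩ := ih _ hlt ((e :: l).filter fun x => ¬ x.row = e.row)
      (by have := hc e.row; linarith) rfl
    rw [List.filter_filter] at hr
    by_cases hre : r = e.row
    · subst hre
      simp at hr
    · refine absurd hr (not_lt.2 ((le_of_eq ?_).trans (hc r)))
      congr 2
      refine List.filter_congr fun x _ => ?_
      by_cases hx : x.row = r <;> simp [hx, hre]

/-- As long as the score is less than the excess of an assignment, some elimination that preserves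
this excess increases the score. -/
theorem exists_score_elim {n : ℕ} {l : List Eqn} (hl : ∀ e ∈ l, e.row.length = n)
    {z : ℕ → Bool} (h : score l < excess l z) :
    ∃ e ∈ l, score l + 1 ≤ score (l.map e.elim) ∧ excess (l.map e.elim) z = excess l z := by
  have hpos : 0 < (l.map fun e => if true ∈ e.row then e.val z else 0).sum := by
    have : excess l z = score l + (l.map fun e => if true ∈ e.row then e.val z else 0).sum := by
      simp only [excess, score, ← List.sum_map_add]
      congr 1
      refine List.map_congr_left fun e _ => ?_
      by_cases he : true ∈ e.row
      · simp [Eqn.const, he]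
      · have hd : ∀ (r : List Bool) (z : ℕ → Bool), true ∉ r → dot r z = false := by
          intro r
          induction r with
          | nil => simp [dot]
          | cons a r ih => cases a <;> simp_all [dot]
        simp [Eqn.const, Eqn.val, he, hd _ _ he]
        cases e.rhs <;> simp
    omega
  obtain ⟨r, hr⟩ := exists_row_class_pos _ _ hpos
  have htrue : true ∈ r := by
    by_contra hc
    refine hr.ne' (List.sum_eq_zero fun x hx => ?_)
    obtain ⟨e, he, rfl⟩ := List.mem_map.1 hx
    obtain rfl : e.row = r := by simpa using (List.mem_filter.1 he).2
    simp [hc]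
  have hclass : ((l.filter fun e => e.row = r).map fun e =>
      if true ∈ e.row then e.val z else 0).sum
      = (l.map fun e => if e.row = r then e.val z else 0).sum := by
    clear hr hpos hl h
    induction l with
    | nil => rfl
    | cons e l ih =>
      by_cases he : e.row = r
      · simp [he, htrue] at ih ⊢
        exact ih
      · simp [he] at ih ⊢
        exact ih
  obtain ⟨e, he, her, hez⟩ : ∃ e ∈ l, e.row = r ∧ dot e.row z = e.rhs := by
    by_contra! hc
    rw [hclass] at hr
    refine hr.not_ge ((List.sum_le_sum (g := fun _ => (0 : ℤ)) fun e he => ?_).trans (by simp))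
    split
    next h' => simp [Eqn.val, hc e he h']
    next => rfl
  refine ⟨e, he, ?_, ?_⟩
  · have : score (l.map e.elim) = score l + (l.map fun e => if e.row = r then e.val z else 0).sum := by
      simp only [score, List.map_map, ← List.sum_map_add]
      congr 1
      refine List.map_congr_left fun e' he' => ?_
      simpa [her] using Eqn.const_elim ((hl e' he').trans (hl e he).symm) hez (her ▸ htrue)
    omega
  · simp only [excess, List.map_map]
    congr 1
    exact List.map_congr_left fun e' he' => Eqn.val_elim ((hl e' he').trans (hl e he).symm) hez

/-- Eliminate with the equation number `j`, if there is one. -/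
def elimAt (l : List Eqn) (j : Option ℕ) : List Eqn :=
  match j.bind fun j => l[j]? with
  | some e => l.map e.elim
  | none => l

theorem elimAt_of_getElem {l : List Eqn} {j : ℕ} (h : j < l.length) :
    elimAt l (some j) = l.map l[j].elim := by
  simp [elimAt, h]

theorem elimAt_length_row {n : ℕ} {l : List Eqn} (hl : ∀ e ∈ l, e.row.length = n)
    (j : Option ℕ) : ∀ e ∈ elimAt l j, e.row.length = n := by
  unfold elimAt
  split
  next e he =>
    obtain ⟨j, -, hj⟩ := Option.bind_eq_some_iff.1 he
    have hm := List.mem_of_getElem? hj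
    intro e' he'
    obtain ⟨e'', he'', rfl⟩ := List.mem_map.1 he'
    rw [Eqn.length_elim _ _ ((hl _ he'').trans (hl _ hm).symm), hl _ he'']
  next => exact hl

theorem length_elimAt (l : List Eqn) (j : Option ℕ) : (elimAt l j).length = l.length := by
  unfold elimAt
  split <;> simp

theorem exists_excess_elimAt {n : ℕ} {l : List Eqn} (hl : ∀ e ∈ l, e.row.length = n)
    (j : Option ℕ) (z : ℕ → Bool) : ∃ z', excess (elimAt l j) z = excess l z' := by
  unfold elimAt
  split
  next e he =>
    obtain ⟨j, -, hj⟩ := Option.bind_eq_some_iff.1 he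
    have hm := List.mem_of_getElem? hj
    obtain ⟨z', hz'⟩ := e.exists_val_eq z
    refine ⟨z', ?_⟩
    simp only [excess, List.map_map]
    congr 1
    exact List.map_congr_left fun e' he' => hz' e' ((hl e' he').trans (hl e hm).symm)
  next => exact ⟨z, rfl⟩

theorem exists_score_foldl_le {n : ℕ} {l : List Eqn} (hl : ∀ e ∈ l, e.row.length = n)
    (js : List (Option ℕ)) : ∃ z, score (js.foldl elimAt l) ≤ excess l z := by
  induction js generalizing l with
  | nil => exact exists_score_le_excess n l hl
  | cons j js ih =>
    obtain ⟨z, hz⟩ := ih (elimAt_length_row hl j)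
    obtain ⟨z', hz'⟩ := exists_excess_elimAt hl j z
    exact ⟨z', hz'.symm ▸ hz⟩

theorem exists_le_score_foldl {n k : ℕ} {l : List Eqn} (hl : ∀ e ∈ l, e.row.length = n)
    {z : ℕ → Bool} (h0 : 0 ≤ score l) (hz : k ≤ excess l z) :
    ∃ js : List ℕ, js.length = k ∧ (∀ j ∈ js, j < l.length) ∧
      k ≤ score ((js.map some).foldl elimAt l) := by
  suffices ∀ t ≤ k, ∃ js : List ℕ, js.length = t ∧ (∀ j ∈ js, j < l.length) ∧
      (t : ℤ) ≤ score ((js.map some).foldl elimAt l) ∧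
      excess ((js.map some).foldl elimAt l) z = excess l z by
    obtain ⟨js, h1, h2, h3, -⟩ := this k le_rfl
    exact ⟨js, h1, h2, h3⟩
  have hfold : ∀ js : List (Option ℕ), (∀ e ∈ js.foldl elimAt l, e.row.length = n) ∧
      (js.foldl elimAt l).length = l.length := fun js => by
    induction js using List.reverseRecOn with
    | nil => exact ⟨hl, rfl⟩
    | append_singleton js j ih =>
      rw [List.foldl_append]
      exact ⟨elimAt_length_row ih.1 j, (length_elimAt _ j).trans ih.2⟩
  intro t
  induction t with
  | zero => exact fun _ => ⟨[], rfl, by simp, by simpa using h0, rfl⟩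
  | succ t ih =>
    intro ht
    obtain ⟨js, h1, h2, h3, h4⟩ := ih (by omega)
    obtain ⟨hlen, hcard⟩ := hfold (js.map some)
    generalize hl' : (js.map some).foldl elimAt l = l' at h3 h4 hlen hcard
    obtain ⟨e, he, hs, hx⟩ : ∃ e ∈ l', ((t + 1 : ℕ) : ℤ) ≤ score (l'.map e.elim) ∧
        excess (l'.map e.elim) z = excess l' z := by
      by_cases hlt : score l' < excess l' z
      · obtain ⟨e, he, hs, hx⟩ := exists_score_elim hlen hlt
        exact ⟨e, he, by push_cast; omega, hx⟩
      · obtain ⟨e, he, hc⟩ : ∃ e ∈ l', e.const ≠ 0 := by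
          by_contra! hc
          have : score l' = 0 := List.sum_eq_zero fun x hx => by
            obtain ⟨e, he, rfl⟩ := List.mem_map.1 hx
            exact hc e he
          omega
        have hid : l'.map e.elim = l' := by
          have hrow : true ∉ e.row := fun hm => hc (by simp [Eqn.const, hm])
          have : e.elim = id := funext fun e' => by simp [Eqn.elim, pivBit_eq_false hrow]
          simp [this]
        exact ⟨e, he, by rw [hid]; omega, by rw [hid]⟩
    obtain ⟨j, hj, rfl⟩ := List.mem_iff_getElem.1 he
    refine ⟨js ++ [j], by simp [h1], ?_, ?_⟩
    · intro i hi
      rcases List.mem_append.1 hi with hi | hi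
      · exact h2 i hi
      · rw [List.mem_singleton.1 hi]
        omega
    · rw [List.map_append, List.foldl_append, hl']
      simp only [List.map_cons, List.map_nil, List.foldl_cons, List.foldl_nil,
        elimAt_of_getElem hj]
      exact ⟨hs, hx.trans h4⟩

end LinAA

namespace LinAA

/-! ## Selecting an equation by halving -/

/-- Keep every other `true`: those whose rank has the parity `b` if `p` is the parity of the first
one. -/
def halve (p b : Bool) : List Bool → List Bool
  | [] => []
  | false :: f => false :: halve p b f
  | true :: f => (p == b) :: halve (!p) b f

theorem length_halve (p b : Bool) (f : List Bool) : (halve p b f).length = f.length := by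
  induction f generalizing p with
  | nil => rfl
  | cons a f ih => cases a <;> simp [halve, ih]

theorem two_mul_count_halve_le (p b : Bool) (f : List Bool) :
    2 * (halve p b f).count true ≤ f.count true + (p == b).toNat := by
  induction f generalizing p with
  | nil => simp [halve]
  | cons a f ih =>
    cases a
    · simpa [halve] using ih p
    · have := ih (!p)
      cases p <;> cases b <;> simp [halve] at this ⊢ <;> omega

theorem exists_halve_getElem (p : Bool) (f : List Bool) (j : ℕ) (h : f[j]? = some true) :
    ∃ b, (halve p b f)[j]? = some true := by
  induction f generalizing p j with
  | nil => simp at h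
  | cons a f ih =>
    obtain _ | j := j
    · obtain rfl : a = true := by simpa using h
      exact ⟨p, by simp [halve]⟩
    · cases a
      · simpa [halve] using ih p j (by simpa using h)
      · simpa [halve] using ih (!p) j (by simpa using h)

/-- The number of the first entry that is left after halving according to the given bits. -/
def selected (m : ℕ) (bits : List Bool) : Option ℕ :=
  (bits.foldl (fun f b => halve false b f) (List.replicate m true)).findIdx? id

theorem exists_selected_eq {m L j : ℕ} (hj : j < m) (hm : m ≤ 2 ^ L) :
    ∃ bits : List Bool, bits.length = L ∧ selected m bits = some j := by
  have key : ∀ (L : ℕ) (f : List Bool), f[j]? = some true → f.count true ≤ 2 ^ L →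
      ∃ bits : List Bool, bits.length = L ∧
        (bits.foldl (fun f b => halve false b f) f)[j]? = some true ∧
        (bits.foldl (fun f b => halve false b f) f).count true ≤ 1 := by
    intro L
    induction L with
    | zero => exact fun f h1 h2 => ⟨[], rfl, h1, by simpa using h2⟩
    | succ L ih =>
      intro f h1 h2
      obtain ⟨b, hb⟩ := exists_halve_getElem false f j h1
      have hc := two_mul_count_halve_le false b f
      have hle : (false == b).toNat ≤ 1 := Bool.toNat_le _
      obtain ⟨bits, h3, h4, h5⟩ := ih (halve false b f) hb (by rw [pow_succ] at h2; omega)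
      exact ⟨b :: bits, by simp [h3], h4, h5⟩
  obtain ⟨bits, h1, h2, h3⟩ := key L (List.replicate m true) (by simp [hj]) (by simpa using hm)
  refine ⟨bits, h1, ?_⟩
  unfold selected
  generalize bits.foldl (fun f b => halve false b f) (List.replicate m true) = f at h2 h3
  clear h1 hj key
  induction f generalizing j with
  | nil => simp at h2
  | cons a f ih =>
    obtain _ | j := j
    · obtain rfl : a = true := by simpa using h2
      simp [List.findIdx?_cons]
    · have hjf : f[j]? = some true := by simpa using h2
      have : 0 < f.count true := List.count_pos_iff.2 (List.mem_of_getElem? hjf)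
      cases a
      · have := ih hjf (by simpa using h3)
        simp [List.findIdx?_cons, this]
      · simp at h3
        omega

/-! ## Binary arithmetic -/

/-- Addition of binary numbers, least significant digit first. -/
def addc : Bool → List Bool → List Bool → List Bool
  | c, [], [] => if c then [true] else []
  | c, a :: x, [] => (a ^^ c) :: addc (a && c) x []
  | c, [], b :: y => (b ^^ c) :: addc (b && c) [] y
  | c, a :: x, b :: y => (a ^^ b ^^ c) :: addc ((a && b) || (a && c) || (b && c)) x y

theorem bits_of_ne_zero {n : ℕ} (h : n ≠ 0) : n.bits = (n % 2 == 1) :: (n / 2).bits := by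
  have h2 : Nat.bit (n % 2 == 1) (n / 2) = n := by
    rcases Nat.mod_two_eq_zero_or_one n with h | h <;> simp [h, Nat.bit] <;> omega
  conv_lhs => rw [← h2]
  refine Nat.bits_append_bit _ _ fun h0 => ?_
  have : n % 2 = 1 := by omega
  simp [this]

theorem addc_bits (c : Bool) (a b : ℕ) : addc c a.bits b.bits = (a + b + c.toNat).bits := by
  induction hs : a + b using Nat.strong_induction_on generalizing a b c with
  | _ s ih =>
    subst hs
    by_cases ha : a = 0
    · subst ha
      by_cases hb : b = 0
      · subst hb
        cases c <;> simp [addc]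
      · rw [bits_of_ne_zero hb, Nat.zero_bits, addc,
          bits_of_ne_zero (n := 0 + b + c.toNat) (by omega), ← Nat.zero_bits,
          ih (0 + b / 2) (by omega) _ _ _ rfl]
        congr 2
        · rcases Nat.mod_two_eq_zero_or_one b with h | h <;> cases c <;>
            simp [h, Nat.add_mod]
        · rcases Nat.mod_two_eq_zero_or_one b with h | h <;> cases c <;>
            simp [h] <;> omega
    · by_cases hb : b = 0
      · subst hb
        rw [bits_of_ne_zero ha, Nat.zero_bits, addc,
          bits_of_ne_zero (n := a + 0 + c.toNat) (by omega), ← Nat.zero_bits,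
          ih (a / 2 + 0) (by omega) _ _ _ rfl]
        congr 2
        · rcases Nat.mod_two_eq_zero_or_one a with h | h <;> cases c <;>
            simp [h, Nat.add_mod]
        · rcases Nat.mod_two_eq_zero_or_one a with h | h <;> cases c <;>
            simp [h] <;> omega
      · rw [bits_of_ne_zero ha, bits_of_ne_zero hb, addc,
          bits_of_ne_zero (n := a + b + c.toNat) (by omega),
          ih (a / 2 + b / 2) (by omega) _ _ _ rfl]
        congr 2
        · rcases Nat.mod_two_eq_zero_or_one a with h | h <;>
            rcases Nat.mod_two_eq_zero_or_one b with h' | h' <;> cases c <;>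
            simp [h, h', Nat.add_mod]
        · rcases Nat.mod_two_eq_zero_or_one a with h | h <;>
            rcases Nat.mod_two_eq_zero_or_one b with h' | h' <;> cases c <;>
            simp [h, h'] <;> omega

/-- Comparison of binary numbers, least significant digit first; `g` is the result for equal
numbers. -/
def cmpb : Bool → List Bool → List Bool → Bool
  | g, [], [] => g
  | g, a :: x, [] => cmpb (if a then true else g) x []
  | g, [], b :: y => cmpb (if b then false else g) [] y
  | g, a :: x, b :: y => cmpb (if a = b then g else a) x y

theorem cmpb_bits (g : Bool) (a b : ℕ) :
    cmpb g a.bits b.bits = if a = b then g else decide (b < a) := by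
  induction hs : a + b using Nat.strong_induction_on generalizing a b g with
  | _ s ih =>
    subst hs
    by_cases ha : a = 0
    · subst ha
      by_cases hb : b = 0
      · subst hb
        simp [cmpb]
      · rw [bits_of_ne_zero hb, Nat.zero_bits, cmpb, ← Nat.zero_bits,
          ih (0 + b / 2) (by omega) _ _ _ rfl]
        have hb' : ¬ 0 = b := fun h => hb h.symm
        by_cases hq : 0 = b / 2 <;> rcases Nat.mod_two_eq_zero_or_one b with h | h
        · omega
        · simp [h, hq.symm, hb']
        · simp [hq, hb']
        · simp [hq, hb']
    · by_cases hb : b = 0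
      · subst hb
        rw [bits_of_ne_zero ha, Nat.zero_bits, cmpb, ← Nat.zero_bits,
          ih (a / 2 + 0) (by omega) _ _ _ rfl]
        have ha' : 0 < a := Nat.pos_of_ne_zero ha
        by_cases hq : a / 2 = 0 <;> rcases Nat.mod_two_eq_zero_or_one a with h | h
        · omega
        · simp [h, hq, ha, ha']
        · simp [hq, ha, ha', Nat.pos_of_ne_zero hq]
        · simp [hq, ha, ha', Nat.pos_of_ne_zero hq]
      · rw [bits_of_ne_zero ha, bits_of_ne_zero hb, cmpb,
          ih (a / 2 + b / 2) (by omega) _ _ _ rfl]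
        have hlt : (b < a) ↔ b / 2 < a / 2 ∨ (a / 2 = b / 2 ∧ b % 2 < a % 2) := by omega
        have heq : (a = b) ↔ (a / 2 = b / 2 ∧ b % 2 = a % 2) := by omega
        by_cases hq : a / 2 = b / 2 <;>
        rcases Nat.mod_two_eq_zero_or_one a with h | h <;>
          rcases Nat.mod_two_eq_zero_or_one b with h' | h' <;>
          simp [h, h', hlt, heq, hq]

/-! ## Systems as lists of equations -/

/-- The equations with `n` coefficients that may occur in a system. -/
structure Eqn.Valid (n : ℕ) (e : Eqn) : Prop where
  length_row : e.row.length = n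
  mem_row : true ∈ e.row
  wt_pos : 0 < e.wt

open MaxLinSystem in
/-- The letters of an equation. -/
def Eqn.letters (e : Eqn) : List SysLetter :=
  e.row.map bitLetter ++ bitLetter e.rhs :: (e.wt.bits.map bitLetter ++ [.sep])

/-- The equations of a system. -/
def eqns (S : MaxLinSystem) : List Eqn :=
  List.ofFn fun j => ⟨List.ofFn fun i => decide (S.A j i ≠ 0), decide (S.b j ≠ 0), S.w j⟩

theorem encode_eq (S : MaxLinSystem) :
    S.encode = List.replicate S.n .one ++ .sep :: ((eqns S).map Eqn.letters).flatten := by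
  have h : ∀ a : ZMod 2, MaxLinSystem.coeffLetter a
      = MaxLinSystem.bitLetter (decide (a ≠ 0)) := fun a => by
    by_cases ha : a = 0 <;> simp [MaxLinSystem.coeffLetter, MaxLinSystem.bitLetter, ha]
  simp only [MaxLinSystem.encode, eqns, List.map_ofFn]
  congr 4
  funext j
  simp only [MaxLinSystem.encodeEq, Eqn.letters, Function.comp, List.map_ofFn, h]
  rfl

theorem valid_eqns (S : MaxLinSystem) : ∀ e ∈ eqns S, e.Valid S.n := by
  intro e he
  obtain ⟨j, rfl⟩ := (List.mem_ofFn' _ _).1 he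
  refine ⟨by simp, ?_, S.w_pos j⟩
  obtain ⟨i, hi⟩ := Function.ne_iff.1 (S.row_ne_zero j)
  exact (List.mem_ofFn' _ _).2 ⟨i, by simpa using hi⟩

theorem exists_eqns_eq {n : ℕ} {l : List Eqn} (hl : ∀ e ∈ l, e.Valid n) :
    ∃ S : MaxLinSystem, S.n = n ∧ eqns S = l := by
  refine ⟨⟨n, l.length, fun j i => if (l.get j).row.getD i false then 1 else 0,
    fun j => if (l.get j).rhs then 1 else 0, fun j => (l.get j).wt,
    fun j => (hl _ (List.get_mem l j)).wt_pos, fun j => ?_⟩, rfl, ?_⟩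
  · obtain ⟨h1, h2, -⟩ := hl _ (List.get_mem l j)
    obtain ⟨i, hi, h3⟩ := List.mem_iff_getElem.1 h2
    refine Function.ne_iff.2 ⟨⟨i, h1 ▸ hi⟩, ?_⟩
    simp only [List.getD_eq_getElem _ _ hi, h3]
    simp
  · refine List.ext_get (by simp [eqns]) fun j h1 h2 => ?_
    have hv := hl _ (List.get_mem l ⟨j, h2⟩)
    simp only [eqns, List.get_ofFn]
    have hrow : (List.ofFn fun i : Fin n =>
        decide ((if l[j].row.getD i false then (1 : ZMod 2) else 0) ≠ 0)) = l[j].row := by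
      refine List.ext_getElem (by simpa using hv.length_row.symm) fun i h3 h4 => ?_
      simp [h4]
    have hrhs : decide ((if l[j].rhs then (1 : ZMod 2) else 0) ≠ 0) = l[j].rhs := by simp
    simp only [List.get_eq_getElem, Fin.val_cast]
    rw [hrow, hrhs]

theorem dot_ofFn {n : ℕ} (a : Fin n → ZMod 2) (z : ℕ → Bool) :
    dot (List.ofFn fun i => decide (a i ≠ 0)) z
      = decide (∑ i, a i * (if z i then 1 else 0) ≠ 0) := by
  induction n generalizing z with
  | zero => simp [dot]
  | succ n ih =>
    have h : ∀ x y : ZMod 2, (decide (x ≠ 0) ^^ decide (y ≠ 0)) = decide (x + y ≠ 0) := by decide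
    have h' : (decide (a 0 ≠ 0) && z 0) = decide (a 0 * (if z 0 then 1 else 0) ≠ 0) := by
      cases z 0
      · rw [Bool.and_false, if_neg (by simp), mul_zero]; rfl
      · rw [Bool.and_true, if_pos rfl, mul_one]
    rw [List.ofFn_succ, dot, ih (fun i => a i.succ), Fin.sum_univ_succ, ← h, h']
    rfl

theorem excess_eqns (S : MaxLinSystem) (z : ℕ → Bool) :
    excess (eqns S) z = S.excess fun i => if z i then 1 else 0 := by
  have hval : ∀ j, S.A.mulVec (fun i => if z i then 1 else 0) j = S.b j ↔
      dot (List.ofFn fun i => decide (S.A j i ≠ 0)) z = decide (S.b j ≠ 0) := fun j => by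
    have h : ∀ x y : ZMod 2, x = y ↔ decide (x ≠ 0) = decide (y ≠ 0) := by decide
    rw [dot_ofFn, h]
    rfl
  simp only [MaxLinSystem.excess, excess, eqns, List.map_ofFn, List.sum_ofFn, ne_eq]
  rw [Finset.sum_filter, Finset.sum_filter, ← Finset.sum_sub_distrib]
  refine Finset.sum_congr rfl fun j _ => ?_
  by_cases hj : S.A.mulVec (fun i => if z i then 1 else 0) j = S.b j
  · rw [Function.comp, Eqn.val, if_pos ((hval j).1 hj), if_pos hj, if_neg (not_not.2 hj), sub_zero]
  · rw [Function.comp, Eqn.val, if_neg fun h => hj ((hval j).2 h), if_neg hj, if_pos hj, zero_sub]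

theorem le_maxExcess_iff (S : MaxLinSystem) (k : ℤ) :
    k ≤ S.maxExcess ↔ ∃ z, k ≤ excess (eqns S) z := by
  rw [MaxLinSystem.maxExcess, Finset.le_sup'_iff]
  constructor
  · rintro ⟨z, -, hz⟩
    refine ⟨fun i => if h : i < S.n then decide (z ⟨i, h⟩ ≠ 0) else false, ?_⟩
    rw [excess_eqns]
    refine hz.trans_eq (congrArg S.excess (funext fun i => ?_))
    have h : ∀ x : ZMod 2, (if x = 0 then (0 : ZMod 2) else 1) = x := by decide
    simp [h]
  · rintro ⟨z, hz⟩
    exact ⟨_, Finset.mem_univ _, excess_eqns S z ▸ hz⟩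

theorem mem_maxLinAA_iff (x : List SysLetter) (k : ℕ) :
    (x, k) ∈ MaxLinAA ↔ ∃ (n : ℕ) (l : List Eqn), (∀ e ∈ l, e.Valid n) ∧
      x = List.replicate n .one ++ .sep :: (l.map Eqn.letters).flatten ∧ ∃ z, k ≤ excess l z := by
  constructor
  · rintro ⟨S, hx, hk⟩
    exact ⟨S.n, eqns S, valid_eqns S, hx.trans (encode_eq S), (le_maxExcess_iff S k).1 hk⟩
  · rintro ⟨n, l, hl, hx, hz⟩
    obtain ⟨S, rfl, rfl⟩ := exists_eqns_eq hl
    exact ⟨S, hx.trans (encode_eq S).symm, (le_maxExcess_iff S k).2 hz⟩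

theorem score_of_valid {n : ℕ} {l : List Eqn} (hl : ∀ e ∈ l, e.Valid n) : score l = 0 :=
  List.sum_eq_zero fun x hx => by
    obtain ⟨e, he, rfl⟩ := List.mem_map.1 hx
    simp [Eqn.const, (hl e he).mem_row]

/-- An excess of at least `k` is witnessed by `k` rounds of elimination, where the equation used in
a round is selected by `L` bits. -/
theorem exists_le_excess_iff {n k L : ℕ} {l : List Eqn} (hl : ∀ e ∈ l, e.Valid n)
    (hL : l.length ≤ 2 ^ L) :
    (∃ z, k ≤ excess l z) ↔ ∃ bs : List (List Bool), bs.length = k ∧ (∀ b ∈ bs, b.length = L) ∧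
      k ≤ score (bs.foldl (fun l b => elimAt l (selected l.length b)) l) := by
  have hlen : ∀ e ∈ l, e.row.length = n := fun e he => (hl e he).length_row
  have hfold : ∀ (bs : List (List Bool)) (l' : List Eqn), l'.length = l.length →
      bs.foldl (fun l b => elimAt l (selected l.length b)) l'
        = (bs.map (selected l.length)).foldl elimAt l' := by
    intro bs
    induction bs with
    | nil => simp
    | cons b bs ih =>
      intro l' hl'
      simp only [List.foldl_cons, List.map_cons]
      rw [ih _ ((length_elimAt _ _).trans hl'), hl']
  constructor
  · rintro ⟨z, hz⟩
    obtain ⟨js, h1, h2, h3⟩ := exists_le_score_foldl hlen (score_of_valid hl).ge hz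
    choose! f hf hf' using fun j (hj : j < l.length) => exists_selected_eq hj hL
    refine ⟨js.map f, by simp [h1], ?_, ?_⟩
    · intro b hb
      obtain ⟨j, hj, rfl⟩ := List.mem_map.1 hb
      exact hf j (h2 j hj)
    · rw [hfold _ _ rfl, List.map_map]
      convert h3 using 3
      exact List.map_congr_left fun j hj => hf' j (h2 j hj)
  · rintro ⟨bs, -, -, hs⟩
    rw [hfold _ _ rfl] at hs
    obtain ⟨z, hz⟩ := exists_score_foldl_le hlen (bs.map (selected l.length))
    exact ⟨z, hs.trans hz⟩

end LinAA

namespace LinAA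

/-! ## Basic programs -/

/-- Load the register `c`. -/
def Reg.setC (v : Reg) (c : Option Sym) : Reg := { v with c := c }

/-- Load the register `c'`. -/
def Reg.setC' (v : Reg) (c : Option Sym) : Reg := { v with c' := c }

@[simp] theorem Reg.setC_setC (v : Reg) (c d : Option Sym) : (v.setC c).setC d = v.setC d := rfl

@[simp] theorem Reg.setC_c (v : Reg) (c : Option Sym) : (v.setC c).c = c := rfl

@[simp] theorem St.set_setV (s : St) (v : Reg) (k : Tape) (x : List Sym) :
    (s.setV v).set k x = (s.set k x).setV v := by
  cases k <;> rfl

theorem St.set_set (s : St) (k : Tape) (x y : List Sym) : (s.set k x).set k y = s.set k y := by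
  cases k <;> rfl

theorem St.set_comm (s : St) {k k' : Tape} (h : k ≠ k') (x y : List Sym) :
    (s.set k x).set k' y = (s.set k' y).set k x := by
  cases k <;> cases k' <;> first | rfl | exact absurd rfl h

theorem St.get_set_self (s : St) (k : Tape) (x : List Sym) : (s.set k x).get k = x := by
  cases k <;> rfl

theorem St.get_set_of_ne (s : St) {k k' : Tape} (h : k' ≠ k) (x : List Sym) :
    (s.set k x).get k' = s.get k' := by
  rw [St.get_set, Function.update_of_ne h]

theorem St.set_get (s : St) (k : Tape) : s.set k (s.get k) = s := by
  cases k <;> rfl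

/-- The code does not use the tape `k`. -/
def Op.Avoids (k : Tape) : Op → Prop
  | nop => True
  | push k' _ => k' ≠ k
  | pop k' _ => k' ≠ k
  | load _ => True
  | seq a b => a.Avoids k ∧ b.Avoids k
  | ite _ a b => a.Avoids k ∧ b.Avoids k

theorem Op.run_set {k : Tape} {o : Op} (h : o.Avoids k) (s : St) (x : List Sym) :
    o.run (s.set k x) = (o.run s).set k x := by
  induction o generalizing s with
  | nop => rfl
  | push k' f =>
    simp only [run, St.get_set_of_ne s h, St.set_v]
    rw [St.set_comm _ (Ne.symm h)]
  | pop k' f =>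
    simp only [run, St.get_set_of_ne s h, St.set_v, St.set_setV]
    rw [St.set_comm _ (Ne.symm h)]
  | load f => simp only [run, St.set_v, St.set_setV]
  | seq a b iha ihb => simp only [run, iha h.1, ihb h.2]
  | ite c a b iha ihb =>
    simp only [run, iha h.1, ihb h.2, St.set_v]
    cases c s.v <;> rfl

/-- Process the letters of a list, each loaded into the register `c`, with the given code. -/
def Op.fold (o : Op) (l : List Sym) (s : St) : St :=
  l.foldl (fun s a => o.run (s.setV (s.v.setC (some a)))) s

@[simp] theorem Op.fold_nil (o : Op) (s : St) : o.fold [] s = s := rfl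

@[simp] theorem Op.fold_cons (o : Op) (a : Sym) (l : List Sym) (s : St) :
    o.fold (a :: l) s = o.fold l (o.run (s.setV (s.v.setC (some a)))) := rfl

theorem Op.fold_append (o : Op) (l l' : List Sym) (s : St) :
    o.fold (l ++ l') s = o.fold l' (o.fold l s) := List.foldl_append

theorem Exec.to {p : Prog} {s s' s'' : St} {l : List Bool} {t t' : ℕ} (h : Exec p s l t s')
    (hs : s' = s'') (ht : t ≤ t') : Exec p s l t' s'' :=
  hs ▸ h.mono ht

/-- Sequential composition without nondeterministic choices in the first program. -/
theorem Exec.comp {p q : Prog} {s s' s'' : St} {l : List Bool} {t t' : ℕ}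
    (hp : Exec p s [] t s') (hq : Exec q s' l t' s'') : Exec (p ;; q) s l (t + t') s'' :=
  Exec.seq (l := []) hp hq

/-- Pop a letter into the register `c`. -/
def popC (k : Tape) : Op := .pop k Reg.setC

/-- Pop a letter into the register `c'`. -/
def popC' (k : Tape) : Op := .pop k Reg.setC'

/-- Push the letter in the register `c`. -/
def pushC (k : Tape) : Op := .push k fun v => v.c.getD .zero

/-- Pop letters from a tape and process them, as long as they satisfy a condition. -/
def popWhile (k : Tape) (q : Option Sym → Bool) (p : Prog) : Prog :=
  .loop (popC k) (fun v => q v.c) p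

/-- Pop all letters from a tape and process them. -/
def popAll (k : Tape) (p : Prog) : Prog := popWhile k Option.isSome p

theorem popC_run (k : Tape) (s : St) (x : List Sym) :
    (popC k).run (s.set k x) = (s.set k x.tail).setV (s.v.setC x.head?) := by
  simp [popC, St.get_set_self, St.set_set]

theorem Exec.popWhile_done {k : Tape} {q : Option Sym → Bool} {p : Prog} (s : St) (x : List Sym)
    (hx : q x.head? = false) : Exec (popWhile k q p) (s.set k x) [] 1
      ((s.set k x.tail).setV (s.v.setC x.head?)) := by
  have := Exec.loop_done (o := popC k) (c := fun v => q v.c) (p := p) (s := s.set k x)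
    (by simpa [popC_run] using hx)
  rwa [popC_run] at this

theorem Exec.popWhile_step {k : Tape} {q : Option Sym → Bool} {p : Prog} {s s' s'' : St}
    {a : Sym} {x : List Sym} {l l' : List Bool} {t t' : ℕ} (ha : q (some a) = true)
    (hp : Exec p ((s.set k x).setV (s.v.setC (some a))) l t s')
    (hl : Exec (popWhile k q p) s' l' t' s'') :
    Exec (popWhile k q p) (s.set k (a :: x)) (l ++ l') (t + 1 + t') s'' := by
  refine Exec.loop_step ?_ ?_ hl
  · simpa [popC_run] using ha
  · rw [popC_run]
    exact hp

theorem Exec.popAll_done {k : Tape} {p : Prog} (s : St) :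
    Exec (popAll k p) (s.set k []) [] 1 ((s.set k []).setV (s.v.setC none)) :=
  Exec.popWhile_done s [] rfl

theorem Exec.popAll_step {k : Tape} {p : Prog} {s s' s'' : St} {a : Sym} {x : List Sym}
    {l : List Bool} {t t' : ℕ} (hp : Exec p ((s.set k x).setV (s.v.setC (some a))) [] t s')
    (hl : Exec (popAll k p) s' l t' s'') :
    Exec (popAll k p) (s.set k (a :: x)) l (t + 1 + t') s'' :=
  Exec.popWhile_step (l := []) rfl hp hl

theorem Exec.popWhile_op {k : Tape} {q : Option Sym → Bool} {o : Op} (ho : o.Avoids k)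
    (l x : List Sym) (hl : ∀ a ∈ l, q (some a) = true) (hx : q x.head? = false) (s : St) :
    Exec (popWhile k q (.op o)) (s.set k (l ++ x)) [] (2 * l.length + 1)
      (((o.fold l s).set k x.tail).setV ((o.fold l s).v.setC x.head?)) := by
  induction l generalizing s with
  | nil => exact .popWhile_done s x hx
  | cons a l ih =>
    have := ih (fun b hb => hl b (by simp [hb])) (o.run (s.setV (s.v.setC (some a))))
    rw [← Op.run_set ho, St.set_setV] at this
    exact (Exec.popWhile_step (l := []) (l' := []) (hl a (by simp)) (.op o _) this).mono
      (by simp; omega)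

theorem Exec.popAll_op {k : Tape} {o : Op} (ho : o.Avoids k) (l : List Sym) (s : St) :
    Exec (popAll k (.op o)) (s.set k l) [] (2 * l.length + 1)
      (((o.fold l s).set k []).setV ((o.fold l s).v.setC none)) := by
  have := Exec.popWhile_op ho l [] (q := Option.isSome) (by simp) rfl s
  rwa [List.append_nil] at this

/-- Move the contents of a tape to another one, thereby reversing it. -/
def move (a b : Tape) : Prog := popAll a (.op (pushC b))

theorem pushC_fold (b : Tape) (l : List Sym) (s : St) :
    (pushC b).fold l s = (s.set b (l.reverse ++ s.get b)).setV (s.v.setC (l.getLast?.or s.v.c)) := by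
  induction l generalizing s with
  | nil => simp only [Op.fold_nil, List.reverse_nil, List.nil_append, St.set_get]; rfl
  | cons a l ih =>
    rw [Op.fold_cons, ih]
    simp only [pushC, Op.run, St.get_setV, St.set_setV, St.get_set_self, St.set_set, St.setV_v,
      St.setV_setV, Reg.setC_setC]
    cases l with
    | nil => simp [Reg.setC]
    | cons => simp [Reg.setC, List.getLast?_cons]

theorem Exec.move {a b : Tape} (hab : a ≠ b) (l : List Sym) (s : St) :
    Exec (move a b) (s.set a l) [] (2 * l.length + 1)
      (((s.set b (l.reverse ++ s.get b)).set a []).setV (s.v.setC none)) := by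
  refine (Exec.popAll_op (o := pushC b) (Ne.symm hab) l s).to ?_ le_rfl
  simp [pushC_fold]

/-! ## Binary arithmetic on tapes -/

/-- The letter for a bit. -/
def bitSym (b : Bool) : Sym := if b then .one else .zero

/-- The bit for a letter. -/
def isOne (c : Option Sym) : Bool := decide (c = some .one)

@[simp] theorem isOne_none : isOne none = false := rfl

@[simp] theorem isOne_bitSym (b : Bool) : isOne (some (bitSym b)) = b := by cases b <;> rfl

/-- The word for a natural number. -/
def binary (n : ℕ) : List Sym := n.bits.map bitSym

/-- Add a pair of digits and the carry. -/
def addOp : Op :=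
  .seq (.push .X fun v => bitSym (isOne v.c ^^ isOne v.c' ^^ v.carry))
    (.load fun v => { v with carry :=
      (isOne v.c && isOne v.c') || (isOne v.c && v.carry) || (isOne v.c' && v.carry) })

/-- Add the number on the tape `W` to the number on the tape `k`. -/
def add (k : Tape) : Prog :=
  .op (.load fun v => { v with carry := false }) ;;
  .loop (.seq (popC .W) (popC' k)) (fun v => v.c.isSome || v.c'.isSome) (.op addOp) ;;
  .op (.ite (fun v => v.carry) (.push .X fun _ => .one) .nop) ;;
  move .X k ;;
  .op (.load fun v => { v with c := none, c' := none, carry := false })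

theorem addc_step (c : Bool) (x y : List Bool) (h : x ≠ [] ∨ y ≠ []) :
    addc c x y = (x.headD false ^^ y.headD false ^^ c) ::
      addc ((x.headD false && y.headD false) || (x.headD false && c) || (y.headD false && c))
        x.tail y.tail := by
  cases x <;> cases y <;> simp_all [addc]

theorem isOne_head? (x : List Bool) : isOne (x.map bitSym).head? = x.headD false := by
  cases x <;> simp

theorem Exec.add_loop {k : Tape} (hW : Tape.W ≠ k) (hX : Tape.X ≠ k) (c : Bool) (x y : List Bool)
    (s : St) (hc : s.v.carry = c) :
    ∃ (d : List Bool) (c' : Bool), d ++ (if c' then [true] else []) = addc c x y ∧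
      Exec (.loop (.seq (popC .W) (popC' k)) (fun v => v.c.isSome || v.c'.isSome) (.op addOp))
        ((s.set .W (x.map bitSym)).set k (y.map bitSym)) [] (2 * (x.length + y.length) + 1)
        ((((s.set .W []).set k []).set .X ((d.map bitSym).reverse ++ s.X)).setV
          { s.v with c := none, c' := none, carry := c' }) := by
  have hrun : ∀ (s : St) (x y : List Sym), (Op.seq (popC .W) (popC' k)).run ((s.set .W x).set k y)
      = ((s.set .W x.tail).set k y.tail).setV { s.v with c := x.head?, c' := y.head? } := by
    intro s x y
    simp only [Op.run, popC, popC', St.set_v, St.setV_v, St.get_setV, St.get_set_self,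
      St.get_set_of_ne _ hW, St.set_setV, St.set_set, 
      St.set_comm _ hW.symm, St.setV_setV]
    rfl
  have hadd : ∀ (s : St) (x y : List Sym) (v : Reg),
      addOp.run (((s.set .W x).set k y).setV v)
      = (((s.set .X (bitSym (isOne v.c ^^ isOne v.c' ^^ v.carry) :: s.X)).set .W x).set k y).setV
        { v with carry :=
          (isOne v.c && isOne v.c') || (isOne v.c && v.carry) || (isOne v.c' && v.carry) } := by
    intro s x y v
    simp only [addOp, Op.run, St.setV_v, St.get_setV, St.set_setV, St.set_comm _ hX.symm,
      St.get_set_of_ne _ hX, St.setV_setV]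
    rfl
  induction hn : x.length + y.length using Nat.strong_induction_on generalizing s c x y with
  | _ n ih =>
    by_cases hxy : x ≠ [] ∨ y ≠ []
    · have hlt : x.tail.length + y.tail.length < n := by
        rw [← hn]
        cases x <;> cases y <;> (simp at hxy ⊢; try omega)
      obtain ⟨d, c', hd, he⟩ := ih _ hlt
        ((x.headD false && y.headD false) || (x.headD false && c) || (y.headD false && c))
        x.tail y.tail
        ((s.set .X (bitSym (x.headD false ^^ y.headD false ^^ c) :: s.X)).setV
          { s.v with
            c := (x.map bitSym).head?, c' := (y.map bitSym).head?
            carry := (x.headD false && y.headD false) || (x.headD false && c) ||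
              (y.headD false && c) })
        rfl rfl
      · refine ⟨(x.headD false ^^ y.headD false ^^ c) :: d, c', ?_, (Exec.loop_step (l := []) (l' := []) ?_ (.op _ _) ?_).mono
          (?_ : 1 + 1 + (2 * (x.tail.length + y.tail.length) + 1) ≤ _)⟩
        · rw [addc_step c x y hxy, ← hd]
          rfl
        · rw [hrun]
          cases x <;> cases y <;> simp_all
        · rw [hrun, hadd]
          refine (cast (congrArg (fun s => Exec _ s _ _ _) ?_) he).to ?_ le_rfl
          · simp only [St.set_setV, isOne_head?, hc, List.map_tail]
          · rw [List.map_cons, List.reverse_cons, List.append_assoc]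
            cases k <;> rfl
        · omega
    · obtain ⟨rfl, rfl⟩ : x = [] ∧ y = [] := by simpa using hxy
      refine ⟨[], c, by cases c <;> simp [addc], (Exec.loop_done ?_).to ?_ (by simp)⟩
      · rw [List.map_nil, hrun]
        rfl
      · rw [List.map_nil, hrun]
        subst hc
        cases k <;> first | rfl | contradiction

theorem length_binary (n : ℕ) : (binary n).length = n.size := by
  rw [binary, List.length_map, Nat.size_eq_bits_len]

theorem size_add_le (a b : ℕ) : (a + b).size ≤ a.size + b.size + 1 := by
  rw [Nat.size_le]
  have ha := Nat.lt_size_self a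
  have hb := Nat.lt_size_self b
  have h1 : 2 ^ a.size ≤ 2 ^ (a.size + b.size) := Nat.pow_le_pow_right (by norm_num) (by omega)
  have h2 : 2 ^ b.size ≤ 2 ^ (a.size + b.size) := Nat.pow_le_pow_right (by norm_num) (by omega)
  rw [pow_succ]
  omega

theorem Exec.add {k : Tape} (hW : Tape.W ≠ k) (hX : Tape.X ≠ k) (a b : ℕ) (s : St)
    (hs : s.X = []) (hc' : s.v.c' = none) (hcarry : s.v.carry = false) :
    Exec (add k) ((s.set .W (binary a)).set k (binary b)) [] (4 * (a.size + b.size) + 8)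
      (((s.set .W []).set k (binary (a + b))).setV (s.v.setC none)) := by
  obtain ⟨d, c', hd, he⟩ := Exec.add_loop hW hX false a.bits b.bits (s.setV s.v) hcarry
  rw [show (s.setV s.v).X = [] from hs] at he
  have hd' : d ++ (if c' then [true] else []) = (a + b).bits := by simpa [addc_bits] using hd
  have hmove := Exec.move hX (binary (a + b)).reverse
    (((s.set .W []).set k []).setV { s.v with c := none, c' := none, carry := c' })
  refine (Exec.comp (.op _ _) (Exec.comp (cast (congrArg (fun s => Exec _ s _ _ _) ?_) he)
    (Exec.comp (.op _ _) (Exec.comp (cast (congrArg (fun s => Exec _ s _ _ _) ?_) hmove)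
      (.op _ _))))).to ?_ ?_
  · rw [Op.run, St.set_setV, St.set_setV]
    congr 1
    rw [← hcarry]
    cases k <;> rfl
  · have : (binary (a + b)).reverse
        = (if c' then [Sym.one] else []) ++ ((d.map bitSym).reverse ++ []) := by
      rw [binary, ← hd']
      cases c' <;> simp [bitSym]
    rw [this]
    cases c' <;> cases k <;> rfl
  · rw [List.reverse_reverse]
    have hv : (s.v.setC none) = { s.v with c := none, c' := none, carry := false } := by
      rw [← hc', ← hcarry]
      rfl
    rw [hv]
    have hsX : s = s.set .X [] := by
      conv_lhs => rw [← St.set_get s .X, show s.get .X = [] from hs]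
    conv_rhs => rw [hsX, show binary (a + b) = binary (a + b) ++ [] by simp]
    cases k <;> first | rfl | contradiction
  · have := size_add_le a b
    simp only [List.length_reverse, length_binary, Nat.size_eq_bits_len]
    omega

end LinAA

namespace LinAA

/-! ## Rounds of elimination on tapes -/

/-- The letters of an equation, with the exception of the mark. -/
def Eqn.body (e : Eqn) : List Sym :=
  e.row.map bitSym ++ bitSym e.rhs :: .tick :: (binary e.wt ++ [.sep])

/-- The letter for a mark. -/
def markSym (b : Bool) : Sym := if b then .live else .dead

/-- The word for a list of marked equations. -/
def word : List Bool → List Eqn → List Sym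
  | b :: f, e :: l => markSym b :: (e.body ++ word f l)
  | _, _ => []

/-- The word for a list of equations all of which may be selected. -/
def liveWord (l : List Eqn) : List Sym := (l.map fun e => Sym.live :: e.body).flatten

theorem word_replicate (l : List Eqn) : word (List.replicate l.length true) l = liveWord l := by
  induction l with
  | nil => rfl
  | cons e l ih => simp [word, liveWord, List.replicate_succ, ih, markSym]

theorem bitSym_ne (b : Bool) : bitSym b ≠ .live ∧ bitSym b ≠ .dead ∧ bitSym b ≠ .tick ∧
    bitSym b ≠ .sep := by
  cases b <;> simp [bitSym]

theorem ne_of_mem_body {e : Eqn} {a : Sym} (ha : a ∈ e.body) : a ≠ .live ∧ a ≠ .dead := by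
  simp only [Eqn.body, binary, List.mem_append, List.mem_map, List.mem_cons, List.not_mem_nil,
    or_false] at ha
  rcases ha with ⟨b, -, rfl⟩ | rfl | rfl | ⟨b, -, rfl⟩ | rfl
  all_goals simp [bitSym_ne]

/-- Forget everything but the phase. -/
def resetOp : Op := .load fun v => { phase := v.phase }

/-- Update the mark of an equation. -/
def selectOp : Op :=
  .ite (fun v => v.c = some .live)
    (.seq (.push .F fun v => markSym (v.par == v.bit)) (.load fun v => { v with par := !v.par }))
    (pushC .F)

theorem selectOp_fold_of_ne (x : List Sym) (hx : ∀ a ∈ x, a ≠ .live) (s : St) :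
    ∃ c, selectOp.fold x s = (s.set .F (x.reverse ++ s.F)).setV (s.v.setC c) := by
  induction x generalizing s with
  | nil => exact ⟨s.v.c, rfl⟩
  | cons a x ih =>
    obtain ⟨c, hc⟩ := ih (fun b hb => hx b (by simp [hb]))
      ((s.set .F (a :: s.F)).setV (s.v.setC (some a)))
    refine ⟨c, ?_⟩
    have : selectOp.run (s.setV (s.v.setC (some a)))
        = (s.set .F (a :: s.F)).setV (s.v.setC (some a)) := by
      simp only [selectOp, Op.run, St.setV_v, Reg.setC_c, Option.some.injEq, hx a (by simp)]
      rfl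
    rw [Op.fold_cons, this, hc, List.reverse_cons, List.append_assoc]
    rfl

theorem selectOp_fold (f : List Bool) (l : List Eqn) (s : St) :
    ∃ v', v'.phase = s.v.phase ∧ selectOp.fold (word f l) s
      = (s.set .F ((word (halve s.v.par s.v.bit f) l).reverse ++ s.F)).setV v' := by
  induction f generalizing l s with
  | nil => exact ⟨s.v, rfl, by cases l <;> rfl⟩
  | cons b f ih =>
    obtain _ | ⟨e, l⟩ := l
    · refine ⟨s.v, rfl, ?_⟩
      cases b <;> rfl
    obtain ⟨b', p, hb', hrun⟩ : ∃ b' p, halve s.v.par s.v.bit (b :: f) = b' :: halve p s.v.bit f ∧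
        selectOp.run (s.setV (s.v.setC (some (markSym b))))
        = (s.set .F (markSym b' :: s.F)).setV { s.v with c := some (markSym b), par := p } := by
      cases b
      · exact ⟨false, s.v.par, rfl, rfl⟩
      · exact ⟨s.v.par == s.v.bit, !s.v.par, rfl, rfl⟩
    obtain ⟨c, hc⟩ := selectOp_fold_of_ne e.body (fun a ha => (ne_of_mem_body ha).1)
      ((s.set .F (markSym b' :: s.F)).setV { s.v with c := some (markSym b), par := p })
    obtain ⟨v', hv', h⟩ := ih l (((s.set .F (e.body.reverse ++ markSym b' :: s.F)).setV
      { s.v with c := c, par := p }))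
    refine ⟨v', hv', ?_⟩
    rw [hb', word, word, Op.fold_cons, hrun, Op.fold_append, hc]
    refine Eq.trans h ?_
    simp only [List.reverse_cons, List.reverse_append, List.append_assoc, List.singleton_append]
    rfl

/-- Halve the set of equations that may be selected. -/
def select : Prog :=
  .op (.load fun v => { phase := v.phase, bit := isOne v.c }) ;;
  popAll .E (.op selectOp) ;; move .F .E ;; .op resetOp

theorem length_word {f f' : List Bool} {l l' : List Eqn} (hf : f.length = f'.length)
    (hl : l.map (fun e => e.body.length) = l'.map fun e => e.body.length) :
    (word f l).length = (word f' l').length := by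
  induction f generalizing f' l l' with
  | nil =>
    obtain rfl : f' = [] := List.length_eq_zero_iff.1 hf.symm
    rfl
  | cons b f ih =>
    obtain _ | ⟨b', f'⟩ := f'
    · simp at hf
    obtain _ | ⟨e, l⟩ := l <;> obtain _ | ⟨e', l'⟩ := l'
    · rfl
    · simp at hl
    · simp at hl
    · simp only [List.map_cons, List.cons.injEq] at hl
      simp [word, hl.1, ih (by simpa using hf) hl.2]

theorem Exec.select (f : List Bool) (l : List Eqn) (b : Bool) (p : Phase) (s : St) :
    Exec select { s with E := word f l, F := [], v := { phase := p, c := some (bitSym b) } } []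
      (4 * (word f l).length + 4)
      { s with E := word (halve false b f) l, F := [], v := { phase := p } } := by
  obtain ⟨v', rfl, h⟩ := selectOp_fold f l { s with F := [], v := { phase := p, bit := b } }
  have h1 := Exec.popAll_op (k := .E) (o := selectOp) (by simp [selectOp, pushC, Op.Avoids])
    (word f l) { s with F := [], v := { phase := v'.phase, bit := b } }
  have h2 := Exec.move (a := .F) (b := .E) (by simp)
    ((word (halve false b f) l).reverse ++ []) { s with E := [], v := v'.setC none }
  rw [h] at h1
  refine (Exec.comp (.op _ _) (Exec.comp (cast (congrArg (fun s => Exec _ s _ _ _) ?_) h1)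
    (Exec.comp h2 (.op _ _)))).to ?_ ?_
  · simp only [Op.run, isOne_bitSym]
    rfl
  · rw [List.append_nil, List.reverse_reverse]
    conv_rhs => rw [← List.append_nil (word _ _)]
    rfl
  · have : (word (halve false b f) l).length = (word f l).length :=
      length_word (length_halve _ _ _) rfl
    simp only [List.append_nil, List.length_reverse, this]
    omega

/-- The first equation that may be selected. -/
def firstLive : List Bool → List Eqn → Option Eqn
  | true :: _, e :: _ => some e
  | false :: f, _ :: l => firstLive f l
  | _, _ => none

theorem firstLive_eq (f : List Bool) (l : List Eqn) :
    firstLive f l = (f.findIdx? id).bind fun j => l[j]? := by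
  induction f generalizing l with
  | nil => rfl
  | cons b f ih =>
    obtain _ | ⟨e, l⟩ := l
    · cases b <;> simp [firstLive]
    · cases b
      · simp only [firstLive, ih, List.findIdx?_cons]
        cases List.findIdx? id f <;> simp
      · simp [firstLive, List.findIdx?_cons]

/-- Clear the register `c` at the end. -/
def Op.clear (o : Op) : Op := .seq o (.load fun v => v.setC none)

/-- Copy the row of the first equation that may be selected to the tape `R` and its right-hand side
to a register, and make all equations selectable. -/
def extractOp : Op := Op.clear <|
  .ite (fun v => v.c = some .live)
    (.seq (.push .F fun _ => .live) (.load fun v => { v with copying := !v.found, found := true })) <|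
  .ite (fun v => v.c = some .dead) (.push .F fun _ => .live) <|
  .ite (fun v => v.c = some .tick)
    (.seq (pushC .F) (.ite (fun v => v.copying)
      (.seq (.pop .R fun v x => { v with rhs := isOne x })
        (.load fun v => { v with copying := false })) .nop)) <|
  .seq (pushC .F) (.ite (fun v => v.copying) (pushC .R) .nop)

theorem extractOp_fold_bits (x : List Bool) (p : Phase) (fd cp q : Bool) (s : St) :
    extractOp.fold (x.map bitSym)
      { s with v := { phase := p, found := fd, copying := cp, rhs := q } }
      = { s with
          F := (x.map bitSym).reverse ++ s.F
          R := if cp then (x.map bitSym).reverse ++ s.R else s.R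
          v := { phase := p, found := fd, copying := cp, rhs := q } } := by
  induction x generalizing s with
  | nil => cases cp <;> rfl
  | cons b x ih =>
    have : extractOp.fold ((b :: x).map bitSym)
        { s with v := { phase := p, found := fd, copying := cp, rhs := q } }
        = extractOp.fold (x.map bitSym) { s with
            F := bitSym b :: s.F
            R := if cp then bitSym b :: s.R else s.R
            v := { phase := p, found := fd, copying := cp, rhs := q } } := by
      cases b <;> cases cp <;> rfl
    rw [this]
    refine (ih { s with
      F := bitSym b :: s.F
      R := if cp then bitSym b :: s.R else s.R }).trans ?_
    cases cp <;> simp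

theorem Eqn.body_eq (e : Eqn) :
    e.body = (e.row ++ [e.rhs]).map bitSym ++ (.tick :: (e.wt.bits.map bitSym ++ [.sep])) := by
  simp [Eqn.body, binary]

theorem extractOp_fold_body (e : Eqn) (p : Phase) (fd q : Bool) (s : St) :
    extractOp.fold e.body { s with v := { phase := p, found := fd, rhs := q } }
      = { s with F := e.body.reverse ++ s.F, v := { phase := p, found := fd, rhs := q } } := by
  have h₁ := extractOp_fold_bits (e.row ++ [e.rhs]) p fd false q s
  have h₂ := extractOp_fold_bits e.wt.bits p fd false q
    { s with F := .tick :: (((e.row ++ [e.rhs]).map bitSym).reverse ++ s.F) }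
  rw [e.body_eq, Op.fold_append, h₁, Op.fold_cons, Op.fold_append]
  refine (congrArg (extractOp.fold [.sep]) h₂).trans ?_
  simp only [List.reverse_append, List.reverse_cons, List.append_assoc]
  rfl

theorem extractOp_fold_body_copying (e : Eqn) (p : Phase) (fd q : Bool) (s : St) :
    extractOp.fold e.body
      { s with R := [], v := { phase := p, found := fd, copying := true, rhs := q } }
      = { s with
          F := e.body.reverse ++ s.F
          R := (e.row.map bitSym).reverse
          v := { phase := p, found := fd, rhs := e.rhs } } := by
  have h₁ := extractOp_fold_bits (e.row ++ [e.rhs]) p fd true q { s with R := [] }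
  have h₂ := extractOp_fold_bits e.wt.bits p fd false e.rhs
    { s with
      F := .tick :: (((e.row ++ [e.rhs]).map bitSym).reverse ++ s.F)
      R := (e.row.map bitSym).reverse }
  rw [e.body_eq, Op.fold_append, h₁, Op.fold_cons, Op.fold_append]
  refine (congrArg (fun s => extractOp.fold [.sep] (extractOp.fold _ s)) ?_).trans
    ((congrArg (extractOp.fold [.sep]) h₂).trans ?_)
  · simp only [if_true, List.map_append, List.reverse_append, List.append_nil]
    cases e.rhs <;> rfl
  · simp only [List.reverse_append, List.reverse_cons, List.append_assoc]
    rfl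

theorem extractOp_fold_found (f : List Bool) (l : List Eqn) (hf : f.length = l.length) (p : Phase)
    (q : Bool) (s : St) :
    extractOp.fold (word f l) { s with v := { phase := p, found := true, rhs := q } }
      = { s with F := (liveWord l).reverse ++ s.F, v := { phase := p, found := true, rhs := q } } := by
  induction l generalizing f s with
  | nil =>
    obtain rfl : f = [] := List.length_eq_zero_iff.1 hf
    rfl
  | cons e l ih =>
    obtain _ | ⟨b, f⟩ := f
    · simp at hf
    have h₁ := extractOp_fold_body e p true q { s with F := .live :: s.F }
    have h₂ := ih f (by simpa using hf) { s with F := e.body.reverse ++ .live :: s.F }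
    rw [word, Op.fold_cons, Op.fold_append]
    refine (congrArg (extractOp.fold _) (Eq.trans ?_ h₁)).trans (h₂.trans ?_)
    · cases b <;> rfl
    · simp [liveWord]

theorem extractOp_fold (f : List Bool) (l : List Eqn) (hf : f.length = l.length) (p : Phase)
    (s : St) :
    extractOp.fold (word f l) { s with R := [], v := { phase := p } }
      = { s with
          F := (liveWord l).reverse ++ s.F
          R := (firstLive f l).elim [] fun e => (e.row.map bitSym).reverse
          v := (firstLive f l).elim { phase := p } fun e =>
            { phase := p, found := true, rhs := e.rhs } } := by
  induction l generalizing f s with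
  | nil =>
    obtain rfl : f = [] := List.length_eq_zero_iff.1 hf
    rfl
  | cons e l ih =>
    obtain _ | ⟨b, f⟩ := f
    · simp at hf
    rw [word, Op.fold_cons, Op.fold_append]
    cases b
    · have h₁ := extractOp_fold_body e p false false { s with F := .live :: s.F, R := [] }
      have h₂ := ih f (by simpa using hf) { s with F := e.body.reverse ++ .live :: s.F }
      refine (congrArg (extractOp.fold _) h₁).trans (h₂.trans ?_)
      simp [liveWord, firstLive]
    · have h₁ := extractOp_fold_body_copying e p true false { s with F := .live :: s.F }
      have h₂ := extractOp_fold_found f l (by simpa using hf) p e.rhs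
        { s with F := e.body.reverse ++ .live :: s.F, R := (e.row.map bitSym).reverse }
      refine (congrArg (extractOp.fold _) h₁).trans (h₂.trans ?_)
      simp [liveWord, firstLive]

/-- Is the letter a bit? -/
def isBit (c : Option Sym) : Bool := c = some .zero || c = some .one

/-- Move a row and the selected row, and find the entry at the pivot. -/
def pivotOp : Op := Op.clear <|
  .seq (pushC .X) <| .seq (popC' .R) <| .seq (.push .R' fun v => v.c'.getD .zero) <|
  .seq (.ite (fun v => isOne v.c') (.load fun v => { v with piv := isOne v.c }) .nop)
    (.load fun v => v.setC' none)

theorem pivotOp_fold (r R : List Bool) (h : r.length = R.length) (p : Phase) (fd q u : Bool)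
    (x : List Sym) (s : St) :
    pivotOp.fold (r.map bitSym).reverse
      { s with
        R := (R.map bitSym).reverse ++ x
        v := { phase := p, found := fd, rhs := q, cur := u } }
      = { s with
          X := r.map bitSym ++ s.X
          R := x
          R' := R.map bitSym ++ s.R'
          v := { phase := p, found := fd, rhs := q, piv := pivBit R r, cur := u } } := by
  induction r generalizing R x with
  | nil =>
    obtain rfl : R = [] := List.length_eq_zero_iff.1 h.symm
    rfl
  | cons a r ih =>
    obtain _ | ⟨b, R⟩ := R
    · simp at h
    rw [List.map_cons, List.reverse_cons, Op.fold_append, List.map_cons, List.reverse_cons,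
      List.append_assoc, ih R (by simpa using h)]
    cases a <;> cases b <;> rfl

/-- Move a row and the selected row back and add them, if the entry at the pivot is one. -/
def addRowOp : Op := Op.clear <|
  .seq (popC' .R') <| .seq (.push .R fun v => v.c'.getD .zero) <|
  .seq (.push .F fun v => bitSym (isOne v.c ^^ (v.piv && isOne v.c'))) (.load fun v => v.setC' none)

theorem addRowOp_fold (r R : List Bool) (h : r.length = R.length) (p : Phase) (fd q u i : Bool)
    (s : St) :
    addRowOp.fold (r.map bitSym)
      { s with
        R' := R.map bitSym
        v := { phase := p, found := fd, rhs := q, piv := i, cur := u } }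
      = { s with
          F := ((if i then List.zipWith xor r R else r).map bitSym).reverse ++ s.F
          R := (R.map bitSym).reverse ++ s.R
          R' := []
          v := { phase := p, found := fd, rhs := q, piv := i, cur := u } } := by
  induction r generalizing R s with
  | nil =>
    obtain rfl : R = [] := List.length_eq_zero_iff.1 h.symm
    cases i <;> rfl
  | cons a r ih =>
    obtain _ | ⟨b, R⟩ := R
    · simp at h
    have := ih R (by simpa using h)
      { s with F := bitSym (a ^^ (i && b)) :: s.F, R := bitSym b :: s.R }
    rw [List.map_cons, Op.fold_cons]
    refine Eq.trans (congrArg _ ?_) (this.trans ?_)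
    · cases a <;> cases b <;> cases i <;> rfl
    · cases i <;> simp

/-- Add the selected equation to an equation, if the entry at the pivot is one. -/
def elimRow : Prog :=
  .op (.seq (pushC .E) (.seq (popC .F) (.load fun v => { v with cur := isOne v.c, c := none }))) ;;
  popWhile .F isBit (.op pivotOp) ;;
  .op (.seq (pushC .F)
    (.seq (.push .E fun v => bitSym (v.cur ^^ (v.piv && v.rhs))) (.load fun v => v.setC none))) ;;
  popAll .X (.op addRowOp) ;;
  popWhile .F isBit (.op (pushC .E)) ;;
  .op (.seq (pushC .E) (.load fun v => { v with c := none, piv := false, cur := false }))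

theorem Exec.elimRow (r R : List Bool) (h : r.length = R.length) (b q : Bool) (p : Phase)
    (f : List Sym) (s : St) :
    Exec elimRow
      { s with
        F := bitSym b :: ((r.map bitSym).reverse ++ .live :: f)
        X := []
        R := (R.map bitSym).reverse
        R' := []
        v := { phase := p, found := true, rhs := q, c := some .tick } } []
      (6 * r.length + 6)
      { s with
        E := .live :: ((if pivBit R r then List.zipWith xor r R else r).map bitSym ++
          bitSym (b ^^ (pivBit R r && q)) :: .tick :: s.E)
        F := f
        X := []
        R := (R.map bitSym).reverse
        R' := []
        v := { phase := p, found := true, rhs := q } } := by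
  have hbit : ∀ a ∈ (r.map bitSym).reverse, isBit (some a) = true := by
    intro a ha
    obtain ⟨c, -, rfl⟩ := List.mem_map.1 (List.mem_reverse.1 ha)
    cases c <;> rfl
  have h1 := Exec.popWhile_op (k := .F) (q := isBit) (o := pivotOp)
    (by simp [pivotOp, Op.clear, pushC, popC', Op.Avoids]) (r.map bitSym).reverse (.live :: f) hbit rfl
    { s with
      E := .tick :: s.E
      X := []
      R := (R.map bitSym).reverse ++ []
      R' := []
      v := { phase := p, found := true, rhs := q, cur := b } }
  have hf1 := pivotOp_fold r R h p true q b []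
    { s with E := .tick :: s.E, X := [], R' := [] }
  have hbit' : ∀ a ∈ ((if pivBit R r then List.zipWith xor r R else r).map bitSym).reverse,
      isBit (some a) = true := by
    intro a ha
    obtain ⟨c, -, rfl⟩ := List.mem_map.1 (List.mem_reverse.1 ha)
    cases c <;> rfl
  have h2 := Exec.popAll_op (k := .X) (o := addRowOp)
    (by simp [addRowOp, Op.clear, popC', Op.Avoids]) (r.map bitSym ++ [])
    { s with
      E := bitSym (b ^^ (pivBit R r && q)) :: .tick :: s.E
      F := .live :: f
      X := []
      R := []
      R' := R.map bitSym ++ []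
      v := { phase := p, found := true, rhs := q, piv := pivBit R r, cur := b } }
  have hf2 := addRowOp_fold r R h p true q b (pivBit R r)
    { s with
      E := bitSym (b ^^ (pivBit R r && q)) :: .tick :: s.E
      F := .live :: f
      X := []
      R := [] }
  have h3 := Exec.popWhile_op (k := .F) (q := isBit) (o := pushC .E)
    (by simp [pushC, Op.Avoids])
    ((if pivBit R r then List.zipWith xor r R else r).map bitSym).reverse (.live :: f) hbit' rfl
    { s with
      E := bitSym (b ^^ (pivBit R r && q)) :: .tick :: s.E
      F := []
      X := []
      R := (R.map bitSym).reverse ++ []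
      R' := []
      v := { phase := p, found := true, rhs := q, piv := pivBit R r, cur := b } }
  have hlen : (if pivBit R r then List.zipWith xor r R else r).length = r.length := by
    split <;> simp [h]
  generalize pivBit R r = i at *
  generalize (if i then List.zipWith xor r R else r) = z at *
  refine (Exec.comp (.op _ _) (Exec.comp (t := 2 * r.length + 1)
    (s' := { s with
      E := .tick :: s.E, F := f, X := r.map bitSym ++ [], R := [], R' := R.map bitSym ++ []
      v := { phase := p, found := true, rhs := q, piv := i, cur := b, c := some .live } }) ?_
    (Exec.comp (.op _ _) (Exec.comp (t := 2 * r.length + 1)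
    (s' := { s with
      E := bitSym (b ^^ (i && q)) :: .tick :: s.E, F := (z.map bitSym).reverse ++ .live :: f
      X := [], R := (R.map bitSym).reverse ++ [], R' := []
      v := { phase := p, found := true, rhs := q, piv := i, cur := b } }) ?_
    (Exec.comp (t := 2 * r.length + 1)
    (s' := { s with
      E := z.map bitSym ++ bitSym (b ^^ (i && q)) :: .tick :: s.E, F := f
      X := [], R := (R.map bitSym).reverse ++ [], R' := []
      v := { phase := p, found := true, rhs := q, piv := i, cur := b, c := some .live } })
      ?_ (.op _ _)))))).to ?_ ?_
  · refine (cast (congrArg (fun s => Exec _ s _ _ _) ?_) h1).to ?_ (by simp)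
    · rw [List.append_nil]
      cases b <;> rfl
    · refine Eq.trans (congrArg (fun s : St => (s.set .F f).setV (s.v.setC (some .live))) hf1) ?_
      rfl
  · refine (cast (congrArg (fun s => Exec _ s _ _ _) ?_) h2).to ?_ (by simp)
    · rfl
    · rw [List.append_nil, List.append_nil]
      exact Eq.trans (congrArg (fun s : St => (s.set .X []).setV (s.v.setC none)) hf2) rfl
  · refine h3.to ?_ (by simp [hlen])
    rw [pushC_fold, List.reverse_reverse]
    rfl
  · rw [List.append_nil]
    rfl
  · omega

end LinAA

namespace LinAA

/-- Every execution of `p` from `s'` yields one from `s` that makes the choices `l` in `t` steps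
first. -/
structure Leads (p : Prog) (s : St) (l : List Bool) (t : ℕ) (s' : St) : Prop where
  exec : ∀ {l' : List Bool} {t' : ℕ} {r : St}, Exec p s' l' t' r → Exec p s (l ++ l') (t + t') r

theorem Leads.refl (p : Prog) (s : St) : Leads p s [] 0 s :=
  ⟨fun h => h.mono (by omega)⟩

theorem Leads.trans {p : Prog} {s s' s'' : St} {l l' : List Bool} {t t' : ℕ}
    (h : Leads p s l t s') (h' : Leads p s' l' t' s'') : Leads p s (l ++ l') (t + t') s'' := by
  refine ⟨fun hr => ?_⟩
  rw [List.append_assoc, Nat.add_assoc]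
  exact h.exec (h'.exec hr)

theorem Leads.to {p : Prog} {s s' s'' : St} {l : List Bool} {t t' : ℕ} (h : Leads p s l t s')
    (hs : s' = s'') (ht : t ≤ t') : Leads p s l t' s'' :=
  ⟨fun hr => (h.exec (hs ▸ hr)).mono (by omega)⟩

theorem Leads.popAll {k : Tape} {p : Prog} {s s' : St} {a : Sym} {x : List Sym} {l : List Bool}
    {t : ℕ} (hp : Exec p ((s.set k x).setV (s.v.setC (some a))) l t s') :
    Leads (popAll k p) (s.set k (a :: x)) l (t + 1) s' :=
  ⟨fun hr => Exec.popWhile_step rfl hp hr⟩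

/-- Eliminate a variable from an equation. -/
def elimBody : Prog :=
  .ite (fun v => v.c = some .tick) elimRow (.op (Op.clear (pushC .E)))

/-- Eliminate a variable from all equations. -/
def elimAll : Prog := popAll .F elimBody ;; popAll .R (.op .nop)

theorem elimBody_leads_of_ne (x : List Sym) (hx : ∀ a ∈ x, a ≠ .tick) (p : Phase) (q : Bool)
    (f : List Sym) (s : St) :
    Leads (popAll .F elimBody)
      { s with F := x ++ f, v := { phase := p, found := true, rhs := q } } [] (3 * x.length)
      { s with
        E := x.reverse ++ s.E, F := f, v := { phase := p, found := true, rhs := q } } := by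
  induction x generalizing s with
  | nil => exact Leads.refl _ _
  | cons a x ih =>
    have ha : a ≠ .tick := hx a (by simp)
    refine ((Leads.popAll (l := []) (k := .F) (a := a) (x := x ++ f)
      (s := { s with F := [], v := { phase := p, found := true, rhs := q } })
      (.ite_false ?_ (.op _ _))).trans
      ((ih (fun b hb => hx b (by simp [hb])) { s with E := a :: s.E }))).to ?_ ?_
    · simp [Reg.setC, ha]
    · simp
    · simp only [List.length_cons]
      omega

theorem Eqn.body_elim (e e' : Eqn) :
    (e.elim e').body = (if pivBit e.row e'.row then List.zipWith xor e'.row e.row else e'.row).map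
      bitSym ++ bitSym (e'.rhs ^^ (pivBit e.row e'.row && e.rhs)) :: .tick ::
        (binary e'.wt ++ [.sep]) := by
  cases h : pivBit e.row e'.row <;> simp [elim, body, h]

theorem elimBody_leads_eqn (e e' : Eqn) (h : e'.row.length = e.row.length) (p : Phase)
    (f : List Sym) (s : St) :
    Leads (popAll .F elimBody)
      { s with
        F := (Sym.live :: e'.body).reverse ++ f
        X := []
        R := (e.row.map bitSym).reverse
        R' := []
        v := { phase := p, found := true, rhs := e.rhs } } [] (6 * (Sym.live :: e'.body).length)
      { s with
        E := .live :: (e.elim e').body ++ s.E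
        F := f
        X := []
        R := (e.row.map bitSym).reverse
        R' := []
        v := { phase := p, found := true, rhs := e.rhs } } := by
  have h1 := elimBody_leads_of_ne (binary e'.wt ++ [Sym.sep]).reverse (by
      intro a ha
      simp only [binary, List.mem_reverse, List.mem_append, List.mem_map, List.mem_singleton] at ha
      rcases ha with ⟨b, -, rfl⟩ | rfl
      · exact (bitSym_ne b).2.2.1
      · simp) p e.rhs (.tick :: bitSym e'.rhs :: ((e'.row.map bitSym).reverse ++ .live :: f))
    { s with X := [], R := (e.row.map bitSym).reverse, R' := [] }
  have h2 := Leads.popAll (k := .F) (Exec.ite_true (c := fun v => v.c = some .tick)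
    (q := .op (Op.clear (pushC .E))) rfl
    (Exec.elimRow e'.row e.row h e'.rhs e.rhs p f { s with E := binary e'.wt ++ [.sep] ++ s.E }))
    (s := { s with
      E := binary e'.wt ++ [.sep] ++ s.E
      X := []
      R := (e.row.map bitSym).reverse
      R' := []
      v := { phase := p, found := true, rhs := e.rhs } })
  rw [List.reverse_reverse] at h1
  refine (cast (congrArg (fun s => Leads _ s _ _ _) ?_) (h1.trans h2)).to ?_ ?_
  · simp [Eqn.body]
  · simp [Eqn.body_elim]
  · simp only [List.length_reverse, List.length_append, List.length_cons, List.length_nil,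
      Eqn.body, List.length_map]
    omega

theorem elimBody_leads (e : Eqn) (l : List Eqn) (h : ∀ e' ∈ l, e'.row.length = e.row.length)
    (p : Phase) (f : List Sym) (s : St) :
    Leads (popAll .F elimBody)
      { s with
        F := (liveWord l).reverse ++ f
        X := []
        R := (e.row.map bitSym).reverse
        R' := []
        v := { phase := p, found := true, rhs := e.rhs } } [] (6 * (liveWord l).length)
      { s with
        E := liveWord (l.map e.elim) ++ s.E
        F := f
        X := []
        R := (e.row.map bitSym).reverse
        R' := []
        v := { phase := p, found := true, rhs := e.rhs } } := by
  induction l generalizing f with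
  | nil => exact Leads.refl _ _
  | cons e' l ih =>
    have h1 := ih (fun e'' he'' => h e'' (by simp [he''])) ((Sym.live :: e'.body).reverse ++ f)
    have h2 := elimBody_leads_eqn e e' (h e' (by simp)) p f
      { s with E := liveWord (l.map e.elim) ++ s.E }
    refine (cast (congrArg (fun s => Leads _ s _ _ _) ?_) (h1.trans h2)).to ?_ ?_
    · simp [liveWord]
    · simp [liveWord]
    · simp [liveWord]
      omega

theorem Op.nop_fold (l : List Sym) (s : St) :
    Op.nop.fold l s = s.setV (s.v.setC (l.getLast?.or s.v.c)) := by
  induction l generalizing s with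
  | nil => rfl
  | cons a l ih =>
    rw [Op.fold_cons, ih]
    cases l with
    | nil => rfl
    | cons => simp [List.getLast?_cons]

theorem Exec.discard (k : Tape) (l : List Sym) (s : St) :
    Exec (popAll k (.op .nop)) (s.set k l) [] (2 * l.length + 1)
      ((s.set k []).setV (s.v.setC none)) := by
  have := Exec.popAll_op (k := k) (o := .nop) trivial l s
  rw [Op.nop_fold] at this
  refine this.to ?_ le_rfl
  cases k <;> rfl

theorem Exec.elimAll (e : Eqn) (l : List Eqn) (h : ∀ e' ∈ l, e'.row.length = e.row.length)
    (p : Phase) (s : St) :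
    Exec elimAll
      { s with
        E := []
        F := (liveWord l).reverse
        X := []
        R := (e.row.map bitSym).reverse
        R' := []
        v := { phase := p, found := true, rhs := e.rhs } } []
      (6 * (liveWord l).length + 2 * e.row.length + 2)
      { s with
        E := liveWord (l.map e.elim)
        F := []
        X := []
        R := []
        R' := []
        v := { phase := p, found := true, rhs := e.rhs } } := by
  have h1 := (elimBody_leads e l h p [] { s with E := [] }).exec (Exec.popAll_done (k := .F)
    { s with
      E := liveWord (l.map e.elim) ++ [], F := [], X := [], R := (e.row.map bitSym).reverse, R' := []
      v := { phase := p, found := true, rhs := e.rhs } })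
  have h2 := Exec.discard .R (e.row.map bitSym).reverse
    { s with
      E := liveWord (l.map e.elim) ++ [], F := [], X := [], R' := []
      v := { phase := p, found := true, rhs := e.rhs } }
  simp only [List.append_nil] at h1 h2
  refine (Exec.comp h1 h2).to ?_ ?_
  · rfl
  · simp
    omega

/-- Use the first equation that may be selected to eliminate a variable. -/
def round : Prog :=
  .op resetOp ;; popAll .E (.op extractOp) ;; .ite (fun v => v.found) elimAll (move .F .E) ;;
  .op resetOp

theorem mem_of_firstLive {f : List Bool} {l : List Eqn} {e : Eqn} (h : firstLive f l = some e) :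
    e ∈ l := by
  rw [firstLive_eq] at h
  obtain ⟨j, -, hj⟩ := Option.bind_eq_some_iff.1 h
  exact List.mem_of_getElem? hj

theorem length_le_length_liveWord {e : Eqn} {l : List Eqn} (h : e ∈ l) :
    e.row.length ≤ (liveWord l).length := by
  induction l with
  | nil => simp at h
  | cons e' l ih =>
    simp only [liveWord, List.map_cons, List.flatten_cons, List.length_append, List.length_cons]
      at ih ⊢
    rcases List.mem_cons.1 h with rfl | h
    · simp [Eqn.body]
      omega
    · have := ih h
      omega

theorem Exec.round {n : ℕ} (f : List Bool) (l : List Eqn) (hf : f.length = l.length)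
    (h : ∀ e ∈ l, e.row.length = n) (p : Phase) (s : St) :
    Exec round
      { s with
        E := word f l, F := [], X := [], R := [], R' := []
        v := { phase := p, c := some .sep } } []
      (10 * (liveWord l).length + 8)
      { s with
        E := liveWord (elimAt l (f.findIdx? id)), F := [], X := [], R := [], R' := []
        v := { phase := p } } := by
  have h1 := Exec.popAll_op (k := .E) (o := extractOp)
    (by simp [extractOp, Op.clear, pushC, Op.Avoids]) (word f l)
    { s with F := [], X := [], R := [], R' := [], v := { phase := p } }
  have h2 := extractOp_fold f l hf p
    { s with F := [], X := [], R' := [] }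
  have hlen : (word f l).length = (liveWord l).length := by
    rw [← word_replicate]
    exact length_word (by simp [hf]) rfl
  rw [elimAt, ← firstLive_eq]
  have h1' := h1.to (congrArg (fun s : St => (s.set .E []).setV (s.v.setC none)) h2)
    (by rw [hlen] : _ ≤ 2 * (liveWord l).length + 1)
  cases hl : firstLive f l with
  | none =>
    rw [hl] at h1'
    refine (Exec.comp (.op _ _) (Exec.comp h1' (Exec.comp (.ite_false rfl
      (Exec.move (a := .F) (b := .E) (by simp) ((liveWord l).reverse ++ [])
        { s with
          E := [], X := [], R := [], R' := [], v := { phase := p } })) (.op _ _)))).to ?_ ?_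
    · rw [List.append_nil, List.reverse_reverse]
      show _ = { s with E := liveWord l, F := [], X := [], R := [], R' := [], v := { phase := p } }
      conv_rhs => rw [← List.append_nil (liveWord l)]
      rfl
    · simp
      omega
  | some e =>
    have he := mem_of_firstLive hl
    have h3 := Exec.elimAll e l (fun e' he' => (h e' he').trans (h e he).symm) p s
    rw [hl] at h1'
    have h1'' : Exec _ _ _ _ { s with
        E := [], F := (liveWord l).reverse, X := [], R := (e.row.map bitSym).reverse, R' := []
        v := { phase := p, found := true, rhs := e.rhs } } :=
      h1'.to (by simp [St.set, St.setV, Reg.setC]) le_rfl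
    refine (Exec.comp (.op _ _) (Exec.comp h1'' (Exec.comp (.ite_true rfl h3) (.op _ _)))).to rfl ?_
    have := length_le_length_liveWord he
    omega

/-- Process the guessed letters: select equations and eliminate. -/
def rounds : Prog := popAll .G (.ite (fun v => v.c = some .sep) round select)

/-- The word for the bits that select the equations. -/
def guessWord (bs : List (List Bool)) : List Sym := (bs.map fun b => b.map bitSym ++ [.sep]).flatten

theorem rounds_leads_select (b : List Bool) (f : List Bool) (l : List Eqn)
    (hf : f.length = l.length) (g : List Sym) (p : Phase) (s : St) :
    Leads rounds
      { s with E := word f l, F := [], G := b.map bitSym ++ g, v := { phase := p } } []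
      (b.length * (10 * (liveWord l).length + 10))
      { s with
        E := word (b.foldl (fun f b => halve false b f) f) l, F := [], G := g
        v := { phase := p } } := by
  induction b generalizing f with
  | nil => exact (Leads.refl _ _).to rfl (by simp)
  | cons a b ih =>
    have h1 : Leads rounds
        { s with E := word f l, F := [], G := bitSym a :: (b.map bitSym ++ g), v := { phase := p } } []
        (4 * (word f l).length + 4 + 1 + 1) _ :=
      Leads.popAll (k := .G) (s := { s with E := word f l, F := [], v := { phase := p } })
        (Exec.ite_false (by cases a <;> rfl)
          (Exec.select f l a p { s with G := b.map bitSym ++ g }))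
    have hlen : (word f l).length = (liveWord l).length := by
      rw [← word_replicate]
      exact length_word (by simp [hf]) rfl
    refine (h1.trans (ih (halve false a f) ((length_halve _ _ _).trans hf))).to rfl ?_
    rw [List.length_cons, hlen, Nat.add_mul]
    omega

theorem length_body_elim (e e' : Eqn) (h : e'.row.length = e.row.length) :
    (e.elim e').body.length = e'.body.length := by
  rw [Eqn.body_elim, Eqn.body]
  split <;> simp [h]

theorem length_liveWord_elimAt {n : ℕ} {l : List Eqn} (h : ∀ e ∈ l, e.row.length = n)
    (j : Option ℕ) : (liveWord (elimAt l j)).length = (liveWord l).length := by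
  rw [← word_replicate, ← word_replicate]
  refine length_word (by simp [length_elimAt]) ?_
  unfold elimAt
  split
  next e he =>
    obtain ⟨j, -, hj⟩ := Option.bind_eq_some_iff.1 he
    have hm := List.mem_of_getElem? hj
    rw [List.map_map]
    exact List.map_congr_left fun e' he' =>
      length_body_elim e e' ((h e' he').trans (h e hm).symm)
  next => rfl

theorem length_foldl_halve (b f : List Bool) :
    (b.foldl (fun f b => halve false b f) f).length = f.length := by
  induction b generalizing f with
  | nil => rfl
  | cons a b ih => exact (ih _).trans (length_halve _ _ _)

theorem Exec.rounds {n : ℕ} (bs : List (List Bool)) (l : List Eqn)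
    (h : ∀ e ∈ l, e.row.length = n) (p : Phase) (s : St) :
    Exec rounds
      { s with
        E := liveWord l, F := [], X := [], R := [], R' := [], G := guessWord bs
        v := { phase := p } } []
      ((guessWord bs).length * (10 * (liveWord l).length + 10) + 1)
      { s with
        E := liveWord (bs.foldl (fun l b => elimAt l (selected l.length b)) l)
        F := [], X := [], R := [], R' := [], G := [], v := { phase := p } } := by
  induction bs generalizing l with
  | nil =>
    exact (Exec.popAll_done (k := .G) { s with
      E := liveWord l, F := [], X := [], R := [], R' := [], v := { phase := p } }).mono
      (Nat.le_add_left _ _)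
  | cons b bs ih =>
    have h1 := rounds_leads_select b (List.replicate l.length true) l (by simp)
      (.sep :: guessWord bs) p { s with X := [], R := [], R' := [] }
    have h2 : Leads LinAA.rounds _ [] (10 * (liveWord l).length + 8 + 1 + 1) _ :=
      Leads.popAll (k := .G)
      (s := { s with
        E := word (b.foldl (fun f b => halve false b f) (List.replicate l.length true)) l
        F := [], X := [], R := [], R' := [], v := { phase := p } })
      (Exec.ite_true rfl (Exec.round (n := n) _ l (by simp [length_foldl_halve]) h p
        { s with G := guessWord bs }))
    have h3 := (h1.trans h2).exec (ih _ (elimAt_length_row h (selected l.length b)))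
    rw [word_replicate] at h3
    refine (cast (congrArg (fun s => Exec _ s _ _ _) ?_) h3).to rfl ?_
    · simp [guessWord]
    · rw [length_liveWord_elimAt h]
      simp only [guessWord, List.map_cons, List.flatten_cons, List.length_append, List.length_map,
        List.length_cons, List.length_nil, Nat.add_mul, Nat.one_mul]
      omega

end LinAA

namespace LinAA

/-! ## The excess of the equations without variables -/

theorem Leads.popAll_ite_op {k : Tape} {c : Reg → Bool} {p : Prog} {o : Op} (ho : o.Avoids k)
    (x f : List Sym) (hx : ∀ a ∈ x, ∀ v : Reg, c (v.setC (some a)) = false) (s : St) :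
    Leads (LinAA.popAll k (.ite c p (.op o))) (s.set k (x ++ f)) [] (3 * x.length)
      ((o.fold x s).set k f) := by
  induction x generalizing s with
  | nil => exact Leads.refl _ _
  | cons a x ih =>
    have h1 : Leads (LinAA.popAll k (.ite c p (.op o))) (s.set k (a :: (x ++ f))) [] (1 + 1 + 1) _ :=
      Leads.popAll (Exec.ite_false (hx a (by simp) s.v) (.op o _))
    have h2 := ih (fun b hb => hx b (by simp [hb])) (o.run (s.setV (s.v.setC (some a))))
    rw [← Op.run_set ho, St.set_setV] at h2
    exact (h1.trans h2).to rfl (by rw [List.length_cons]; omega)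

/-- Collect the weight of an equation without variables. -/
def sumOp : Op := Op.clear <|
  .ite (fun v => v.c = some .live) .nop <|
  .ite (fun v => v.c = some .tick) (.load fun v => { v with copying := true }) <|
  .ite (fun v => v.copying) (.ite (fun v => v.nz) .nop (pushC .R')) <|
  .load fun v => { v with nz := v.nz || v.last, last := isOne v.c }

/-- Add the weight of an equation without variables. -/
def sumEnd : Prog :=
  .op (.load fun v => v.setC none) ;;
  .ite (fun v => v.nz) (.op .nop) (move .R' .W ;; .ite (fun v => v.last) (add .N) (add .P)) ;;
  .op resetOp

/-- Compute the total weights of the satisfied and of the falsified equations without variables. -/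
def sum : Prog := popAll .E (.ite (fun v => v.c = some .sep) sumEnd (.op sumOp))

/-- The weight of an equation without variables that is satisfied. -/
def Eqn.pos (e : Eqn) : ℕ := if true ∈ e.row ∨ e.rhs = true then 0 else e.wt

/-- The weight of an equation without variables that is falsified. -/
def Eqn.neg (e : Eqn) : ℕ := if true ∈ e.row ∨ e.rhs = false then 0 else e.wt

theorem score_eq (l : List Eqn) : score l = (l.map Eqn.pos).sum - (l.map Eqn.neg).sum := by
  induction l with
  | nil => rfl
  | cons e l ih =>
    have : e.const = e.pos - e.neg := by
      by_cases h : true ∈ e.row <;> cases h' : e.rhs <;> simp [Eqn.const, Eqn.pos, Eqn.neg, h, h']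
    simp only [score, List.map_cons, List.sum_cons, Nat.cast_add] at ih ⊢
    rw [ih, this]
    ring

theorem sumOp_fold_row (r : List Bool) (q : Bool) (p : Phase) (a b : Bool) (s : St) :
    sumOp.fold (r.map bitSym ++ [bitSym q]) { s with v := { phase := p, nz := a, last := b } }
      = { s with v := { phase := p, nz := a || b || decide (true ∈ r), last := q } } := by
  induction r generalizing a b with
  | nil => cases a <;> cases b <;> cases q <;> rfl
  | cons d r ih =>
    refine Eq.trans ?_ ((ih (a || b) d).trans ?_)
    · cases d <;> cases a <;> cases b <;> rfl
    · cases d <;> simp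

theorem sumOp_fold_wt (x : List Bool) (p : Phase) (a b : Bool) (s : St) :
    sumOp.fold (x.map bitSym) { s with v := { phase := p, copying := true, nz := a, last := b } }
      = { s with
          R' := if a then s.R' else (x.map bitSym).reverse ++ s.R'
          v := { phase := p, copying := true, nz := a, last := b } } := by
  induction x generalizing s with
  | nil => cases a <;> rfl
  | cons d x ih =>
    refine Eq.trans ?_ ((ih { s with R' := if a then s.R' else bitSym d :: s.R' }).trans ?_)
    · cases d <;> cases a <;> rfl
    · cases a <;> simp

theorem sumOp_fold (e : Eqn) (p : Phase) (s : St) :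
    sumOp.fold (.live :: (e.row.map bitSym ++ bitSym e.rhs :: .tick :: binary e.wt))
      { s with R' := [], v := { phase := p } }
      = { s with
          R' := if true ∈ e.row then [] else (binary e.wt).reverse
          v := { phase := p, copying := true, nz := decide (true ∈ e.row), last := e.rhs } } := by
  have h1 := sumOp_fold_row e.row e.rhs p false false { s with R' := [] }
  have h2 := sumOp_fold_wt e.wt.bits p (decide (true ∈ e.row)) e.rhs { s with R' := [] }
  rw [show Sym.live :: (e.row.map bitSym ++ bitSym e.rhs :: .tick :: binary e.wt)
    = .live :: ((e.row.map bitSym ++ [bitSym e.rhs]) ++ .tick :: binary e.wt) by simp,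
    Op.fold_cons, Op.fold_append]
  refine (congrArg (sumOp.fold _) h1).trans ((Eq.trans ?_ h2).trans ?_)
  · rw [Op.fold_cons]
    simp only [Bool.false_or]
    rfl
  · by_cases h : true ∈ e.row <;> simp [h, binary]

theorem Exec.sumEnd (e : Eqn) (a b Z : ℕ) (ha : a.size ≤ Z) (hb : b.size ≤ Z) (p : Phase) (s : St) :
    Exec sumEnd { s with
        R' := if true ∈ e.row then [] else (binary e.wt).reverse
        X := [], W := [], P := binary a, N := binary b
        v := { phase := p, copying := true, nz := decide (true ∈ e.row), last := e.rhs
               c := some .sep } } []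
      (6 * e.wt.size + 4 * Z + 14)
      { s with R' := [], X := [], W := [], P := binary (a + e.pos), N := binary (b + e.neg)
               v := { phase := p } } := by
  by_cases h : true ∈ e.row
  · simp only [h, if_true, decide_true, Eqn.pos, Eqn.neg, true_or, Nat.add_zero]
    exact (Exec.comp (.op _ _) (Exec.comp (.ite_true rfl (.op _ _)) (.op _ _))).to rfl (by omega)
  · have h1 := Exec.move (a := .R') (b := .W) (by simp) (binary e.wt).reverse
      { s with
        X := [], W := [], P := binary a, N := binary b
        v := { phase := p, copying := true, nz := false, last := e.rhs } }
    rw [List.reverse_reverse, List.length_reverse, length_binary] at h1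
    simp only [h, if_false, decide_false, Eqn.pos, Eqn.neg, false_or]
    cases hr : e.rhs
    · rw [hr] at h1
      have h2 := Exec.add (k := .P) (by simp) (by simp) e.wt a
        { s with
          R' := [], X := [], N := binary b
          v := { phase := p, copying := true, last := false } } rfl rfl rfl
      refine (Exec.comp (.op _ _) (Exec.comp (.ite_false rfl (Exec.comp h1
        (Exec.ite_false rfl (cast (congrArg (fun s => Exec _ s _ _ _) ?_) h2)))) (.op _ _))).to ?_ ?_
      · conv_lhs => rw [← List.append_nil (binary e.wt)]
        rfl
      · simp [Nat.add_comm a]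
        rfl
      · omega
    · rw [hr] at h1
      have h2 := Exec.add (k := .N) (by simp) (by simp) e.wt b
        { s with
          R' := [], X := [], P := binary a
          v := { phase := p, copying := true, last := true } } rfl rfl rfl
      refine (Exec.comp (.op _ _) (Exec.comp (.ite_false rfl (Exec.comp h1
        (Exec.ite_true rfl (cast (congrArg (fun s => Exec _ s _ _ _) ?_) h2)))) (.op _ _))).to ?_ ?_
      · conv_lhs => rw [← List.append_nil (binary e.wt)]
        rfl
      · simp [Nat.add_comm b]
        rfl
      · omega

theorem sum_leads_eqn (e : Eqn) (f : List Sym) (a b Z : ℕ) (ha : a.size ≤ Z) (hb : b.size ≤ Z)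
    (p : Phase) (s : St) :
    Leads sum { s with
        E := .live :: (e.body ++ f)
        R' := [], X := [], W := [], P := binary a, N := binary b, v := { phase := p } } []
      ((Sym.live :: e.body).length * (4 * Z + 25))
      { s with
        E := f
        R' := [], X := [], W := [], P := binary (a + e.pos), N := binary (b + e.neg)
        v := { phase := p } } := by
  have h1 := Leads.popAll_ite_op (k := .E) (c := fun v => v.c = some .sep) (p := sumEnd)
    (o := sumOp) (by simp [sumOp, Op.clear, pushC, Op.Avoids])
    (.live :: (e.row.map bitSym ++ bitSym e.rhs :: .tick :: binary e.wt)) (.sep :: f) (by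
      intro x hx v
      simp only [binary, List.mem_cons, List.mem_append, List.mem_map] at hx
      have h0 := fun b => (bitSym_ne b).2.2.2
      rcases hx with rfl | ⟨b, -, rfl⟩ | rfl | rfl | ⟨b, -, rfl⟩ <;> simp [h0])
    { s with R' := [], X := [], W := [], P := binary a, N := binary b, v := { phase := p } }
  have hf := sumOp_fold e p { s with X := [], W := [], P := binary a, N := binary b }
  have h2 : Leads sum _ [] (6 * e.wt.size + 4 * Z + 14 + 1 + 1) _ :=
    Leads.popAll (k := .E) (a := .sep) (x := f)
    (s := { s with
        R' := if true ∈ e.row then [] else (binary e.wt).reverse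
        X := [], W := [], P := binary a, N := binary b
        v := { phase := p, copying := true, nz := decide (true ∈ e.row), last := e.rhs } })
    (Exec.ite_true rfl (Exec.sumEnd e a b Z ha hb p { s with E := f }))
  refine (cast (congrArg (fun s => Leads _ s _ _ _) ?_) ((h1.to (congrArg (fun s : St =>
    s.set .E (.sep :: f)) hf) le_rfl).trans h2)).to rfl ?_
  · simp only [Eqn.body, List.append_assoc, List.cons_append, List.nil_append]
    rfl
  · simp only [Eqn.body, List.length_cons, List.length_append, List.length_map, length_binary,
      List.length_nil]
    nlinarith [Nat.zero_le (e.row.length * Z), Nat.zero_le (e.wt.size * Z)]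

theorem sum_leads (l : List Eqn) (f : List Sym) (a b Z : ℕ)
    (ha : (a + (l.map Eqn.pos).sum).size ≤ Z) (hb : (b + (l.map Eqn.neg).sum).size ≤ Z)
    (p : Phase) (s : St) :
    Leads sum { s with
        E := liveWord l ++ f
        R' := [], X := [], W := [], P := binary a, N := binary b, v := { phase := p } } []
      ((liveWord l).length * (4 * Z + 25))
      { s with
        E := f
        R' := [], X := [], W := [], P := binary (a + (l.map Eqn.pos).sum)
        N := binary (b + (l.map Eqn.neg).sum), v := { phase := p } } := by
  induction l generalizing a b with
  | nil => exact (Leads.refl _ _).to rfl (by simp)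
  | cons e l ih =>
    simp only [List.map_cons, List.sum_cons, ← Nat.add_assoc] at ha hb ⊢
    have h1 := sum_leads_eqn e (liveWord l ++ f) a b Z
      ((Nat.size_le_size (by omega)).trans ha) ((Nat.size_le_size (by omega)).trans hb) p s
    refine (cast (congrArg (fun s => Leads _ s _ _ _) ?_) (h1.trans (ih _ _ ha hb))).to rfl ?_
    · simp [liveWord]
    · simp only [liveWord, List.map_cons, List.flatten_cons, List.length_append, Nat.add_mul]
      exact le_rfl

theorem size_sum_le (g : Eqn → ℕ) (hg : ∀ e, g e ≤ e.wt) (l : List Eqn) :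
    (l.map g).sum.size ≤ (liveWord l).length := by
  induction l with
  | nil => simp
  | cons e l ih =>
    have h1 := size_add_le (g e) (l.map g).sum
    have h2 := Nat.size_le_size (hg e)
    simp only [liveWord, List.map_cons, List.flatten_cons, List.sum_cons, List.length_append,
      List.length_cons, Eqn.body, length_binary, List.length_nil] at ih ⊢
    omega

theorem Exec.sum (l : List Eqn) (k : ℕ) (p : Phase) (s : St) :
    Exec sum { s with
        E := liveWord l
        R' := [], X := [], W := [], P := [], N := binary k, v := { phase := p } } []
      ((liveWord l).length * (4 * (k + (liveWord l).length + 1) + 25) + 1)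
      { s with
        E := []
        R' := [], X := [], W := [], P := binary (l.map Eqn.pos).sum
        N := binary (k + (l.map Eqn.neg).sum), v := { phase := p } } := by
  have hpos := size_sum_le Eqn.pos (fun e => by unfold Eqn.pos; split <;> omega) l
  have hneg := size_sum_le Eqn.neg (fun e => by unfold Eqn.neg; split <;> omega) l
  have hk := size_add_le k (l.map Eqn.neg).sum
  have hk' : k.size ≤ k := Nat.size_le.2 Nat.lt_two_pow_self
  have h := (sum_leads l [] 0 k (k + (liveWord l).length + 1) (by rw [Nat.zero_add]; omega)
    (by omega) p s).exec (Exec.popAll_done (k := .E) { s with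
        R' := [], X := [], W := [], P := binary (0 + (l.map Eqn.pos).sum)
        N := binary (k + (l.map Eqn.neg).sum), v := { phase := p } })
  simp only [List.append_nil, Nat.zero_add] at h
  exact h.to rfl le_rfl

/-- Compare the numbers on the tapes `P` and `N`. -/
def compare : Prog :=
  .loop (.seq (popC .P) (popC' .N)) (fun v => v.c.isSome || v.c'.isSome) <| .op <|
    .load fun v => { v with ge := if isOne v.c = isOne v.c' then v.ge else isOne v.c }

theorem Exec.compare_loop (g : Bool) (x y : List Bool) (p : Phase) (c c' : Option Sym) (s : St) :
    Exec compare { s with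
        P := x.map bitSym, N := y.map bitSym, v := { phase := p, c := c, c' := c', ge := g } } []
      (2 * (x.length + y.length) + 1)
      { s with P := [], N := [], v := { phase := p, ge := cmpb g x y } } := by
  induction g, x, y using cmpb.induct generalizing c c' with
  | case1 g => exact (Exec.loop_done rfl).to (by simp only [cmpb]; rfl) (by omega)
  | case2 g a x ih =>
    refine (Exec.loop_step (l := []) (l' := []) rfl (.op _ _)
      (cast (congrArg (fun s => Exec _ s _ _ _) ?_)
      (ih (some (bitSym a)) none))).to (by simp [cmpb])
      (by simp; omega)
    cases a <;> cases g <;> rfl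
  | case3 g b y ih =>
    refine (Exec.loop_step (l := []) (l' := []) rfl (.op _ _)
      (cast (congrArg (fun s => Exec _ s _ _ _) ?_)
      (ih none (some (bitSym b))))).to (by simp [cmpb])
      (by simp; omega)
    cases b <;> cases g <;> rfl
  | case4 g a x b y ih =>
    refine (Exec.loop_step (l := []) (l' := []) rfl (.op _ _)
      (cast (congrArg (fun s => Exec _ s _ _ _) ?_)
      (ih (some (bitSym a)) (some (bitSym b))))).to (by simp [cmpb])
      (by simp; omega)
    cases a <;> cases b <;> cases g <;> rfl

theorem Exec.compare (a b : ℕ) (p : Phase) (s : St) :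
    Exec compare { s with P := binary a, N := binary b, v := { phase := p } } []
      (2 * (a.size + b.size) + 1)
      { s with P := [], N := [], v := { phase := p, ge := decide (b ≤ a) } } := by
  refine (Exec.compare_loop true a.bits b.bits p none none s).to ?_ ?_
  · have : (if a = b then true else decide (b < a)) = decide (b ≤ a) := by
      by_cases h : a = b
      · simp [h]
      · simp only [h, if_false, decide_eq_decide]
        omega
    rw [cmpb_bits, this]
  · simp [Nat.size_eq_bits_len]

end LinAA

namespace LinAA

/-! ## Guessing -/

/-- Push the number one on the tape `W`. -/
def pushOne : Op := .seq (.push .W fun _ => .one) (.load fun v => v.setC none)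

/-- Increment the number on the tape `k`. -/
def incr (k : Tape) : Prog := .op pushOne ;; add k

theorem Exec.incr {k : Tape} (hW : Tape.W ≠ k) (hX : Tape.X ≠ k) (a : ℕ) (p : Phase)
    (c : Option Sym) (s : St) (hs : s.X = []) (hs' : s.W = []) :
    Exec (incr k) ((s.set k (binary a)).setV { phase := p, c := c }) [] (4 * a.size + 13)
      ((s.set k (binary (a + 1))).setV { phase := p }) := by
  have h := Exec.add hW hX 1 a (s.setV { phase := p }) hs rfl rfl
  refine (Exec.comp (.op _ _) (cast (congrArg (fun s => Exec _ s _ _ _) ?_) h)).to ?_ ?_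
  · obtain ⟨⟩ := s
    cases hs'
    cases k <;> first | rfl | exact absurd rfl hW
  · rw [Nat.add_comm 1]
    obtain ⟨⟩ := s
    cases hs'
    cases k <;> rfl
  · have : (1 : ℕ).size = 1 := by simp
    omega

/-- Write the number of letters on the tape `U` to the tape `L`. -/
def count : Prog := popAll .U (incr .L)

theorem size_le_self (a : ℕ) : a.size ≤ a := Nat.size_le.2 Nat.lt_two_pow_self

theorem Exec.count (x : List Sym) (i : ℕ) (p : Phase) (s : St) :
    Exec count { s with U := x, X := [], W := [], L := binary i, v := { phase := p } } []
      (x.length * (4 * (x.length + i) + 15) + 1)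
      { s with U := [], X := [], W := [], L := binary (i + x.length), v := { phase := p } } := by
  induction x generalizing i with
  | nil =>
    exact (Exec.popAll_done (k := .U) { s with
      U := [], X := [], W := [], L := binary i, v := { phase := p } }).mono (by simp)
  | cons a x ih =>
    have h1 := Exec.incr (k := .L) (by simp) (by simp) i p (some a) { s with U := x, X := [], W := [] }
      rfl rfl
    refine (Exec.popAll_step (k := .U) (x := x) (a := a) (s := { s with
      U := a :: x, X := [], W := [], L := binary i, v := { phase := p } }) h1 (ih (i + 1))).to ?_ ?_
    · simp only [List.length_cons, Nat.add_assoc, Nat.add_comm 1]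
    · have := size_le_self i
      simp only [List.length_cons]
      nlinarith

theorem length_tail_binary (a : ℕ) : (binary a).tail.length = Nat.log 2 a := by
  rw [List.length_tail, length_binary]
  rcases Nat.eq_zero_or_pos a with rfl | ha
  · simp
  · have h1 : a < 2 ^ a.size := Nat.lt_size_self a
    have h2 : 2 ^ (a.size - 1) ≤ a := Nat.lt_size.1 (by have := Nat.size_pos.2 ha; omega)
    exact (Nat.log_eq_of_pow_le_of_lt_pow h2
      (by rwa [Nat.sub_add_cancel (Nat.size_pos.2 ha)])).symm

/-- Copy a letter to the tape `L'` and push a mark on the tape `B`. -/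
def tallyOp : Op := Op.clear (.seq (pushC .L') (.push .B fun _ => .tick))

/-- Prepare the guesses: for each letter of the tape `K`, count it on the tape `N` and push a
separator and as many marks as there are letters on the tape `L` on the tape `B`. -/
def budget : Prog := popAll .K <| incr .N ;; popAll .L (.op tallyOp) ;; move .L' .L ;;
  .op (.push .B fun _ => .sep)

/-- Marks for `k` guesses of `m` bits. -/
def budgetWord (k m : ℕ) : List Sym :=
  (List.replicate k (Sym.sep :: List.replicate m Sym.tick)).flatten

theorem tallyOp_fold (y : List Sym) (p : Phase) (s : St) :
    tallyOp.fold y { s with v := { phase := p } }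
      = { s with
          L' := y.reverse ++ s.L', B := List.replicate y.length .tick ++ s.B
          v := { phase := p } } := by
  induction y generalizing s with
  | nil => rfl
  | cons a y ih =>
    refine (ih { s with L' := a :: s.L', B := .tick :: s.B }).trans ?_
    simp [List.replicate_succ', List.append_assoc]

theorem Exec.budget (x y : List Sym) (i j : ℕ) (p : Phase) (s : St) :
    Exec budget { s with
        K := x, L := y, L' := [], X := [], W := [], N := binary i, B := budgetWord j y.length
        v := { phase := p } } []
      (x.length * (4 * (x.length + i) + 4 * y.length + 20) + 1)
      { s with
        K := [], L := y, L' := [], X := [], W := [], N := binary (i + x.length)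
        B := budgetWord (j + x.length) y.length, v := { phase := p } } := by
  induction x generalizing i j with
  | nil =>
    exact (Exec.popAll_done (k := .K) { s with
      K := [], L := y, L' := [], X := [], W := [], N := binary i, B := budgetWord j y.length
      v := { phase := p } }).mono (by simp)
  | cons a x ih =>
    have h1 := Exec.incr (k := .N) (by simp) (by simp) i p (some a)
      { s with K := x, L := y, L' := [], X := [], W := [], B := budgetWord j y.length } rfl rfl
    have h2 := Exec.popAll_op (k := .L) (o := tallyOp)
      (by simp [tallyOp, Op.clear, pushC, Op.Avoids]) y { s with
        K := x, L' := [], X := [], W := [], N := binary (i + 1), B := budgetWord j y.length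
        v := { phase := p } }
    have hf := tallyOp_fold y p { s with
      K := x, L' := [], X := [], W := [], N := binary (i + 1), B := budgetWord j y.length }
    have h2' := h2.to (congrArg (fun s : St => (s.set .L []).setV (s.v.setC none)) hf) le_rfl
    have h3 := Exec.move (a := .L') (b := .L) (by simp) (y.reverse ++ []) { s with
      K := x, L := [], X := [], W := [], N := binary (i + 1)
      B := List.replicate y.length .tick ++ budgetWord j y.length, v := { phase := p } }
    have h3' := h3.to (s'' := { s with
      K := x, L := y, L' := [], X := [], W := [], N := binary (i + 1)
      B := List.replicate y.length .tick ++ budgetWord j y.length, v := { phase := p } })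
      (by simp [St.set, St.get, St.setV, Reg.setC]) le_rfl
    refine (Exec.popAll_step (k := .K) (x := x) (a := a) (s := { s with
      L := y, L' := [], X := [], W := [], N := binary i, B := budgetWord j y.length
      v := { phase := p } }) (Exec.comp h1 (Exec.comp h2' (Exec.comp h3' (.op _ _))))
      (cast (congrArg (fun s => Exec _ s _ _ _) ?_) (ih (i + 1) (j + 1)))).to ?_ ?_
    · rw [budgetWord, List.replicate_succ, List.flatten_cons]
      rfl
    · simp only [List.length_cons, Nat.add_assoc, Nat.add_comm 1]
    · have := size_le_self i
      simp only [List.length_cons, List.length_append, List.length_reverse, List.length_nil]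
      nlinarith

/-- Replace the marks by guessed bits. -/
def guess : Prog := popAll .B <| .ite (fun v => v.c = some .tick)
  (.flip ;; .op (.seq (.push .G fun v => bitSym v.bit) resetOp))
  (.op (.seq (.push .G fun _ => .sep) resetOp))

/-- Split a list of bits into the guesses it encodes. -/
def blocks : ℕ → ℕ → List Bool → List (List Bool)
  | 0, _, _ => []
  | k + 1, m, l => blocks k m (l.drop m) ++ [(l.take m).reverse]

theorem length_blocks (k m : ℕ) (l : List Bool) : (blocks k m l).length = k := by
  induction k generalizing l with
  | zero => rfl
  | succ k ih => simp [blocks, ih]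

theorem length_of_mem_blocks {k m : ℕ} {l : List Bool} (h : l.length = k * m) {b : List Bool}
    (hb : b ∈ blocks k m l) : b.length = m := by
  induction k generalizing l with
  | zero => simp [blocks] at hb
  | succ k ih =>
    rw [Nat.add_mul, Nat.one_mul] at h
    rcases List.mem_append.1 hb with hb | hb
    · exact ih (by simp [h]) hb
    · simp only [List.mem_singleton] at hb
      simp [hb, h]

theorem exists_blocks_eq {k m : ℕ} {bs : List (List Bool)} (h : bs.length = k)
    (hbs : ∀ b ∈ bs, b.length = m) : ∃ l, l.length = k * m ∧ blocks k m l = bs := by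
  induction k generalizing bs with
  | zero => exact ⟨[], by simp, (List.length_eq_zero_iff.1 h).symm⟩
  | succ k ih =>
    rcases List.eq_nil_or_concat bs with rfl | ⟨bs, b, rfl⟩
    · simp at h
    · simp only [List.concat_eq_append] at *
      obtain ⟨l, hl, hl'⟩ := ih (bs := bs) (by simpa using h) (fun b hb => hbs b (by simp [hb]))
      have hb : b.reverse.length = m := by simpa using hbs b (by simp)
      refine ⟨b.reverse ++ l, by simp only [List.length_append, hb, hl]; ring, ?_⟩
      rw [blocks, List.drop_left' hb, List.take_left' hb, hl', List.reverse_reverse]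

theorem guess_leads_ticks (l : List Bool) (f g : List Sym) (p : Phase) (s : St) :
    Leads guess { s with
        B := List.replicate l.length .tick ++ f, G := g, v := { phase := p } } l (4 * l.length)
      { s with B := f, G := (l.map bitSym).reverse ++ g, v := { phase := p } } := by
  induction l generalizing g with
  | nil => exact Leads.refl _ _
  | cons b l ih =>
    have h1 : Leads guess _ [b] (1 + 1 + 1 + 1) _ := Leads.popAll (k := .B) (a := .tick)
      (x := List.replicate l.length .tick ++ f) (s := { s with G := g, v := { phase := p } })
      (Exec.ite_true rfl (Exec.seq (.flip b _) (.op _ _)))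
    refine (h1.trans (ih (bitSym b :: g))).to ?_ ?_
    · simp
    · simp only [List.length_cons]
      omega

theorem guess_leads (k m : ℕ) (l : List Bool) (hl : l.length = k * m) (bs : List (List Bool))
    (p : Phase) (s : St) :
    Leads guess { s with B := budgetWord k m, G := guessWord bs, v := { phase := p } } l
      (4 * (k * (m + 1)))
      { s with B := [], G := guessWord (blocks k m l ++ bs), v := { phase := p } } := by
  induction k generalizing l bs with
  | zero =>
    obtain rfl : l = [] := List.length_eq_zero_iff.1 (by simpa using hl)
    exact (Leads.refl _ _).to rfl (by simp)
  | succ k ih =>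
    rw [Nat.add_mul, Nat.one_mul] at hl
    have h1 : Leads guess _ [] (1 + 1 + 1) _ := Leads.popAll (k := .B) (a := .sep)
      (x := List.replicate m .tick ++ budgetWord k m)
      (s := { s with G := guessWord bs, v := { phase := p } })
      (Exec.ite_false rfl (.op _ _))
    have h2 := guess_leads_ticks (l.take m) (budgetWord k m) (.sep :: guessWord bs) p s
    rw [show (l.take m).length = m by simp [hl]] at h2
    have h3 := ih (l.drop m) (by simp [hl]) ((l.take m).reverse :: bs)
    have h4 := h2.trans (cast (congrArg (fun s => Leads _ s _ _ _) ?_) h3)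
    · rw [List.take_append_drop] at h4
      refine (cast (congrArg (fun s => Leads _ s _ _ _) ?_) (h1.trans h4)).to ?_ ?_
      · simp only [budgetWord, List.replicate_succ, List.flatten_cons]
        rfl
      · simp [blocks]
      · ring_nf
        omega
    · simp [guessWord]

theorem Exec.guess (k m : ℕ) (l : List Bool) (hl : l.length = k * m) (p : Phase) (s : St) :
    Exec guess { s with B := budgetWord k m, G := [], v := { phase := p } } l
      (4 * (k * (m + 1)) + 1)
      { s with B := [], G := guessWord (blocks k m l), v := { phase := p } } := by
  have h := (guess_leads k m l hl [] p s).exec (Exec.popAll_done (k := .B)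
    { s with G := guessWord (blocks k m l ++ []), v := { phase := p } })
  rw [List.append_nil] at h
  refine h.to ?_ le_rfl
  rw [List.append_nil]
  rfl

end LinAA

namespace LinAA

/-! ## Reading the input -/

/-- Reject the input. -/
def badOp : Op := .load fun v => { v with phase := .bad }

/-- Read a bit of a row or a right-hand side, depending on whether the counter on the tape `k` is
positive, and increment the counter on the tape `k'`. -/
def bitOp (k k' : Tape) : Op :=
  .seq (popC' k) <| .seq (pushC .F) <| .ite (fun v => v.c'.isSome)
    (.seq (.push k' fun _ => .one)
      (.load fun v => { v with c' := none, nz := v.nz || isOne v.c, phase := .row }))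
    (.seq (.push .F fun _ => .tick)
      (.load fun v => { v with swapped := !v.swapped, phase := .weight }))

/-- Read a letter of a row or a right-hand side. -/
def rowOp : Op :=
  .ite (fun v => isBit v.c) (.ite (fun v => v.swapped) (bitOp .C₁ .C₀) (bitOp .C₀ .C₁)) badOp

/-- Read a letter of a weight. -/
def weightOp : Op :=
  .ite (fun v => isBit v.c) (.seq (pushC .F) (.load fun v => { v with last := isOne v.c })) <|
  .ite (fun v => v.c = some .sep && v.nz && v.last)
    (.seq (pushC .F) (.load fun v => { phase := .start, swapped := v.swapped })) badOp

/-- Read a letter of the header. -/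
def headerOp : Op :=
  .ite (fun v => v.c = some .one) (.push .C₀ fun _ => .one) <|
  .ite (fun v => v.c = some .sep) (.load fun v => { v with phase := .start }) badOp

/-- Read a letter of the input. -/
def readOp : Op := Op.clear <| .seq (.ite (fun v => v.c = some .tick) .nop (.push .U fun _ => .tick)) <|
  .ite (fun v => v.phase = .header) headerOp <|
  .ite (fun v => v.phase = .start)
    (.ite (fun v => v.c = some .tick) (pushC .K) (.seq (.push .F fun _ => .live) rowOp)) <|
  .ite (fun v => v.phase = .row) rowOp <|
  .ite (fun v => v.phase = .weight) weightOp badOp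

/-- The tape letter for a letter of a system. -/
def sysSym (a : SysLetter) : Sym := inputSym (some a)

/-- States that occur while the input is read: `a` letters are on the counter that is decremented
and `i` letters on the other one. -/
def reading (ph : Phase) (sw nz last : Bool) (a i : ℕ) (f : List Sym) (u : ℕ) : St where
  C₀ := List.replicate (if sw then i else a) .one
  C₁ := List.replicate (if sw then a else i) .one
  F := f
  U := List.replicate u .tick
  v := { phase := ph, swapped := sw, nz := nz, last := last }

open MaxLinSystem in
@[simp] theorem sysSym_bitLetter (b : Bool) : sysSym (bitLetter b) = bitSym b := by cases b <;> rfl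

theorem readOp_fold_header (n a u : ℕ) (y : List Sym) :
    readOp.fold (List.replicate n .one ++ .sep :: y) (reading .header false false false a 0 [] u)
      = readOp.fold y (reading .start false false false (a + n) 0 [] (u + n + 1)) := by
  induction n generalizing a u with
  | zero => rfl
  | succ n ih =>
    refine (ih (a + 1) (u + 1)).trans ?_
    rw [Nat.add_assoc a, Nat.add_comm 1, Nat.add_assoc u, Nat.add_comm 1]

theorem readOp_fold_row (r : List Bool) (q sw nz : Bool) (i u : ℕ) (f y : List Sym) :
    readOp.fold (r.map bitSym ++ bitSym q :: y) (reading .row sw nz false r.length i f u)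
      = readOp.fold y (reading .weight (!sw) (nz || decide (true ∈ r)) false (i + r.length) 0
          (.tick :: bitSym q :: ((r.map bitSym).reverse ++ f)) (u + r.length + 1)) := by
  induction r generalizing nz i u f with
  | nil => cases q <;> cases sw <;> cases nz <;> rfl
  | cons b r ih =>
    refine Eq.trans ?_ ((ih (nz || b) (i + 1) (u + 1) (bitSym b :: f)).trans ?_)
    · cases b <;> cases sw <;> cases nz <;> rfl
    · rw [List.length_cons, Nat.add_assoc i, Nat.add_comm 1, Nat.add_assoc u, Nat.add_comm 1]
      cases b <;> cases nz <;> simp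

theorem readOp_fold_start (b sw : Bool) (n i u : ℕ) (f y : List Sym) :
    readOp.fold (bitSym b :: y) (reading .start sw false false n i f u)
      = readOp.fold (bitSym b :: y) (reading .row sw false false n i (.live :: f) u) := by
  cases b <;> cases sw <;> cases n <;> rfl

theorem readOp_fold_weight (x : List Bool) (sw last : Bool) (a i u : ℕ) (f y : List Sym)
    (h : x.getLastD last = true) :
    readOp.fold (x.map bitSym ++ .sep :: y) (reading .weight sw true last a i f u)
      = readOp.fold y (reading .start sw false false a i (.sep :: ((x.map bitSym).reverse ++ f))
          (u + x.length + 1)) := by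
  induction x generalizing last u f with
  | nil =>
    obtain rfl : last = true := h
    rfl
  | cons b x ih =>
    refine Eq.trans ?_ ((ih b (u + 1) (bitSym b :: f) (by rwa [List.getLastD_cons] at h)).trans ?_)
    · cases b <;> rfl
    · rw [List.length_cons, Nat.add_assoc u, Nat.add_comm 1]
      simp

theorem getLastD_bits {n : ℕ} (h : 0 < n) (b : Bool) : n.bits.getLastD b = true := by
  induction n using Nat.strong_induction_on generalizing b with
  | _ n ih =>
    rw [bits_of_ne_zero h.ne', List.getLastD_cons]
    rcases Nat.eq_zero_or_pos (n / 2) with h2 | h2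
    · obtain rfl : n = 1 := by omega
      rfl
    · exact ih _ (by omega) h2 _

theorem exists_bits_eq {x : List Bool} (h : x.getLastD false = true) : ∃ n, 0 < n ∧ n.bits = x := by
  induction x with
  | nil => simp at h
  | cons b x ih =>
    rw [List.getLastD_cons] at h
    obtain _ | ⟨c, x⟩ := x
    · obtain rfl : b = true := h
      exact ⟨1, by simp, by simp⟩
    · obtain ⟨n, hn, hx⟩ := ih (by rwa [List.getLastD_cons] at h ⊢)
      refine ⟨Nat.bit b n, Nat.pos_of_ne_zero fun h0 => hn.ne' (Nat.bit_eq_zero_iff.1 h0).1, ?_⟩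
      rw [Nat.bits_append_bit _ _ (fun h0 => absurd h0 hn.ne'), hx]

theorem map_letters (e : Eqn) : e.letters.map sysSym
    = e.row.map bitSym ++ bitSym e.rhs :: (e.wt.bits.map bitSym ++ [.sep]) := by
  simp [Eqn.letters, Function.comp_def]
  rfl

theorem readOp_fold_letters {n : ℕ} {e : Eqn} (he : e.Valid n) (sw : Bool) (u : ℕ)
    (f y : List Sym) :
    readOp.fold (e.letters.map sysSym ++ y) (reading .start sw false false n 0 f u)
      = readOp.fold y (reading .start (!sw) false false n 0 ((Sym.live :: e.body).reverse ++ f)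
          (u + e.letters.length)) := by
  obtain ⟨rfl, hrow, hwt⟩ := he
  obtain ⟨row, rhs, wt⟩ := e
  have h1 := readOp_fold_row row rhs sw false 0 u (.live :: f) (wt.bits.map bitSym ++ .sep :: y)
  have h2 := readOp_fold_weight wt.bits (!sw) false row.length 0 (u + row.length + 1)
    (.tick :: bitSym rhs :: ((row.map bitSym).reverse ++ .live :: f)) y (getLastD_bits hwt false)
  have h0 : readOp.fold (row.map bitSym ++ bitSym rhs :: (wt.bits.map bitSym ++ .sep :: y))
      (reading .start sw false false row.length 0 f u)
      = readOp.fold (row.map bitSym ++ bitSym rhs :: (wt.bits.map bitSym ++ .sep :: y))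
      (reading .row sw false false row.length 0 (.live :: f) u) := by
    obtain _ | ⟨b, row⟩ := row <;> exact readOp_fold_start _ _ _ _ _ _ _
  rw [map_letters]
  simp only [List.append_assoc, List.cons_append, List.nil_append]
  simp only [Bool.false_or, Nat.zero_add, show decide (true ∈ row) = true by simpa using hrow] at h1
  rw [h0, h1, h2]
  congr 2
  · simp [Eqn.body, binary]
  · simp only [Eqn.letters, List.length_append, List.length_cons, List.length_map, List.length_nil]
    omega

theorem readOp_fold_eqns {n : ℕ} {l : List Eqn} (hl : ∀ e ∈ l, e.Valid n) (sw : Bool) (u : ℕ)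
    (f : List Sym) :
    ∃ sw', readOp.fold ((l.map Eqn.letters).flatten.map sysSym)
        (reading .start sw false false n 0 f u)
      = reading .start sw' false false n 0 ((liveWord l).reverse ++ f)
          (u + (l.map Eqn.letters).flatten.length) := by
  induction l generalizing sw u f with
  | nil => exact ⟨sw, rfl⟩
  | cons e l ih =>
    obtain ⟨sw', h⟩ := ih (fun e' he' => hl e' (by simp [he'])) (!sw) (u + e.letters.length)
      ((Sym.live :: e.body).reverse ++ f)
    refine ⟨sw', ?_⟩
    rw [List.map_cons, List.flatten_cons, List.map_append,
      readOp_fold_letters (hl e (by simp)), h]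
    simp [liveWord, Nat.add_assoc]

theorem readOp_fold_ticks (k n u : ℕ) (sw : Bool) (f x : List Sym) :
    readOp.fold (List.replicate k .tick) { reading .start sw false false n 0 f u with K := x }
      = { reading .start sw false false n 0 f u with K := List.replicate k .tick ++ x } := by
  induction k generalizing x with
  | zero => rfl
  | succ k ih =>
    refine (ih (.tick :: x)).trans ?_
    rw [List.replicate_succ', List.append_assoc]
    rfl

theorem readOp_fold_bad (y : List Sym) (s : St) (h : s.v.phase = .bad) :
    (readOp.fold y s).v.phase = .bad := by
  induction y generalizing s with
  | nil => exact h
  | cons a y ih =>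
    refine ih _ ?_
    obtain ⟨v⟩ := s
    obtain ⟨c, c', ph⟩ := v
    obtain rfl : ph = .bad := h
    cases a <;> rfl

theorem readOp_fold_cons_ne (a : Sym) (y : List Sym) (s : St)
    (h : (readOp.run (s.setV (s.v.setC (some a)))).v.phase = .bad) :
    (readOp.fold (a :: y) s).v.phase ≠ .start := by
  rw [Op.fold_cons, readOp_fold_bad _ _ h]
  exact nofun

theorem readOp_fold_ticks_ne (k : ℕ) (s : St) (h : s.v.phase ≠ .start) :
    (readOp.fold (List.replicate k .tick) s).v.phase ≠ .start := by
  induction k generalizing s with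
  | zero => exact h
  | succ k ih =>
    refine ih _ ?_
    obtain ⟨v⟩ := s
    obtain ⟨c, c', ph⟩ := v
    have h' : ph ≠ .start := h
    cases ph
    · exact (nofun : Phase.bad ≠ .start)
    · exact absurd rfl h'
    all_goals exact (nofun : Phase.bad ≠ .start)

theorem exists_header_of_phase {x : List SysLetter} {a u : ℕ}
    (h : (readOp.fold (x.map sysSym) (reading .header false false false a 0 [] u)).v.phase
      = .start) : ∃ n x', x = List.replicate n .one ++ .sep :: x' := by
  induction x generalizing a u with
  | nil => exact absurd h nofun
  | cons c x ih =>
    cases c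
    · exact absurd h (readOp_fold_cons_ne _ _ _ rfl)
    · obtain ⟨n, x', rfl⟩ := ih (a := a + 1) (u := u + 1) h
      exact ⟨n + 1, x', rfl⟩
    · exact ⟨0, x, rfl⟩

open MaxLinSystem in
theorem exists_row_of_phase {x : List SysLetter} {sw nz : Bool} {a i u : ℕ} {f : List Sym}
    (h : (readOp.fold (x.map sysSym) (reading .row sw nz false a i f u)).v.phase = .start) :
    ∃ (r : List Bool) (q : Bool) (x' : List SysLetter), r.length = a ∧
      x = r.map bitLetter ++ bitLetter q :: x' := by
  have hx : ∃ b x', x = bitLetter b :: x' := by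
    obtain _ | ⟨c, x⟩ := x
    · exact absurd h nofun
    · cases c
      · exact ⟨false, x, rfl⟩
      · exact ⟨true, x, rfl⟩
      · exact absurd h (readOp_fold_cons_ne _ _ _ rfl)
  induction a generalizing x nz i u f with
  | zero =>
    obtain ⟨b, x', rfl⟩ := hx
    exact ⟨[], b, x', rfl, rfl⟩
  | succ a ih =>
    obtain ⟨b, x', rfl⟩ := hx
    have h' : (readOp.fold (x'.map sysSym)
        (reading .row sw (nz || b) false a (i + 1) (bitSym b :: f) (u + 1))).v.phase = .start := by
      refine Eq.trans ?_ h
      cases b <;> cases sw <;> cases nz <;> rfl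
    obtain ⟨r, q, x'', hr, rfl⟩ := ih h' (by
      obtain _ | ⟨c, x⟩ := x'
      · exact absurd h' nofun
      · cases c
        · exact ⟨false, x, rfl⟩
        · exact ⟨true, x, rfl⟩
        · exact absurd h' (readOp_fold_cons_ne _ _ _ rfl))
    exact ⟨b :: r, q, x'', by simp [hr], rfl⟩

open MaxLinSystem in
theorem exists_weight_of_phase {x : List SysLetter} {sw nz last : Bool} {a i u : ℕ} {f : List Sym}
    (h : (readOp.fold (x.map sysSym) (reading .weight sw nz last a i f u)).v.phase = .start) :
    ∃ (r : List Bool) (x' : List SysLetter), nz = true ∧ r.getLastD last = true ∧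
      x = r.map bitLetter ++ .sep :: x' := by
  induction x generalizing last u f with
  | nil => exact absurd h nofun
  | cons c x ih =>
    cases c
    · obtain ⟨r, x', hnz, hr, rfl⟩ := ih (last := false) (u := u + 1) (f := .zero :: f) h
      exact ⟨false :: r, x', hnz, by rwa [List.getLastD_cons], rfl⟩
    · obtain ⟨r, x', hnz, hr, rfl⟩ := ih (last := true) (u := u + 1) (f := .one :: f) h
      exact ⟨true :: r, x', hnz, by rwa [List.getLastD_cons], rfl⟩
    · cases nz <;> cases last
      iterate 3 exact absurd h (readOp_fold_cons_ne _ _ _ rfl)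
      exact ⟨[], x, rfl, rfl, rfl⟩

open MaxLinSystem in
theorem exists_eqns_of_phase {n : ℕ} {x : List SysLetter} {sw : Bool} {u : ℕ} {f : List Sym}
    (h : (readOp.fold (x.map sysSym) (reading .start sw false false n 0 f u)).v.phase = .start) :
    ∃ l : List Eqn, (∀ e ∈ l, e.Valid n) ∧ x = (l.map Eqn.letters).flatten := by
  induction hx : x.length using Nat.strong_induction_on generalizing x sw u f with
  | _ t ih =>
    subst hx
    obtain _ | ⟨c, x⟩ := x
    · exact ⟨[], by simp, rfl⟩
    obtain ⟨b, rfl⟩ : ∃ b, c = bitLetter b := by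
      cases c
      · exact ⟨false, rfl⟩
      · exact ⟨true, rfl⟩
      · exact absurd h (readOp_fold_cons_ne _ _ _ rfl)
    rw [List.map_cons, sysSym_bitLetter, readOp_fold_start, ← sysSym_bitLetter, ← List.map_cons] at h
    obtain ⟨r, q, x', rfl, hr⟩ := exists_row_of_phase h
    rw [hr] at h ih ⊢
    simp only [List.map_append, List.map_map, List.map_cons, Function.comp_def,
      sysSym_bitLetter] at h
    rw [readOp_fold_row] at h
    obtain ⟨y, x'', hnz, hy, rfl⟩ := exists_weight_of_phase h
    rw [hnz] at h
    simp only [List.map_append, List.map_map, List.map_cons, Function.comp_def,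
      sysSym_bitLetter] at h
    have h' := (congrArg (fun s : St => s.v.phase)
      (readOp_fold_weight _ _ _ _ _ _ _ _ hy)).symm.trans h
    rw [Nat.zero_add] at h'
    obtain ⟨l, hl, rfl⟩ := ih _ (by simp; omega) h' rfl
    obtain ⟨w, hw, rfl⟩ := exists_bits_eq hy
    refine ⟨⟨r, q, w⟩ :: l, ?_, ?_⟩
    · intro e he
      rcases List.mem_cons.1 he with rfl | he
      · exact ⟨rfl, by simpa using hnz, hw⟩
      · exact hl e he
    · simp [Eqn.letters]

/-- Read the input. -/
def readInput : Prog := popAll .I (.op readOp)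

theorem map_inputSym_paramInput (x : List SysLetter) (k : ℕ) :
    (paramInput x k).map inputSym = x.map sysSym ++ List.replicate k .tick := by
  simp [paramInput, Function.comp_def, sysSym, inputSym]

theorem Exec.readInput (x : List Sym) :
    Exec readInput { I := x } [] (2 * x.length + 1)
      (((readOp.fold x {}).set .I []).setV ((readOp.fold x {}).v.setC none)) :=
  Exec.popAll_op (k := .I) (o := readOp) (by
    simp [readOp, headerOp, rowOp, weightOp, bitOp, badOp, Op.clear, pushC, popC', Op.Avoids]) x {}

end LinAA

namespace LinAA

/-! ## The machine for Max Lin AA -/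

/-- The list of equations `l` in `n` variables is presented by the word `x`. -/
def Presents (x : List SysLetter) (n : ℕ) (l : List Eqn) : Prop :=
  (∀ e ∈ l, e.Valid n) ∧ x = List.replicate n .one ++ .sep :: (l.map Eqn.letters).flatten

theorem Presents.readOp_fold {x : List SysLetter} {n : ℕ} {l : List Eqn} (h : Presents x n l)
    (k : ℕ) : ∃ sw, readOp.fold (x.map sysSym ++ List.replicate k .tick) {}
      = { reading .start sw false false n 0 (liveWord l).reverse x.length with
          K := List.replicate k .tick } := by
  obtain ⟨hl, rfl⟩ := h
  obtain ⟨sw, h2⟩ := readOp_fold_eqns hl false (n + 1) []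
  have h1 := readOp_fold_header n 0 0 ((l.map Eqn.letters).flatten.map sysSym)
  have h3 := readOp_fold_ticks k n (n + 1 + (l.map Eqn.letters).flatten.length) sw
    (liveWord l).reverse []
  simp only [Nat.zero_add, List.append_nil] at h1 h2 h3
  refine ⟨sw, ?_⟩
  rw [Op.fold_append, List.map_append, List.map_replicate, List.map_cons]
  refine (congrArg (readOp.fold _) (h1.trans h2)).trans (h3.trans ?_)
  simp [Nat.add_assoc, Nat.add_comm 1]

theorem exists_presents_of_phase {x : List SysLetter} {k : ℕ}
    (h : (readOp.fold (x.map sysSym ++ List.replicate k .tick) {}).v.phase = .start) :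
    ∃ n l, Presents x n l := by
  rw [Op.fold_append] at h
  have h' : (readOp.fold (x.map sysSym) (reading .header false false false 0 0 [] 0)).v.phase
      = .start := by
    by_contra hne
    exact readOp_fold_ticks_ne k _ hne h
  obtain ⟨n, y, rfl⟩ := exists_header_of_phase h'
  have h1 := readOp_fold_header n 0 0 (y.map sysSym)
  rw [List.map_append, List.map_replicate, List.map_cons] at h'
  rw [Nat.zero_add] at h1
  obtain ⟨l, hl, rfl⟩ := exists_eqns_of_phase
    ((congrArg (fun s : St => s.v.phase) h1).symm.trans h')
  exact ⟨n, l, hl, rfl⟩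

theorem length_liveWord_le (l : List Eqn) :
    (liveWord l).length ≤ 2 * (l.map Eqn.letters).flatten.length ∧
      2 * l.length ≤ (l.map Eqn.letters).flatten.length := by
  induction l with
  | nil => simp [liveWord]
  | cons e l ih =>
    simp only [liveWord, List.map_cons, List.flatten_cons, List.length_append, List.length_cons,
      Eqn.body, Eqn.letters, List.length_map, length_binary, Nat.size_eq_bits_len,
      List.length_nil] at ih ⊢
    omega

/-- Was the input well-formed? -/
def wellFormed (v : Reg) : Bool := v.phase = .start

/-- Prepare the guesses. -/
def prepare : Prog :=
  popAll .C₀ (.op .nop) ;; popAll .C₁ (.op .nop) ;; move .F .E ;; count ;;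
  .op (.pop .L fun v _ => v) ;; budget

/-- The program for Max Lin AA. -/
def solve : Prog :=
  readInput ;; .op resetOp ;; .ite wellFormed prepare (.op .nop) ;; guess ;;
  .ite wellFormed (rounds ;; sum ;; compare) (.op .nop)

/-- The states in which the program accepts. -/
def accepting (v : Reg) : Bool := wellFormed v && v.ge

theorem Exec.prepare (l : List Eqn) (sw : Bool) (n u k : ℕ) :
    Exec prepare
      { reading .start sw false false n 0 (liveWord l).reverse u with
        K := List.replicate k .tick, v := { phase := .start } } []
      (2 * n + 2 * (liveWord l).length + u * (4 * u + 15) + k * (4 * k + 4 * Nat.log 2 u + 20) + 6)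
      { E := liveWord l, L := (binary u).tail, N := binary k, B := budgetWord k (Nat.log 2 u)
        v := { phase := .start } } := by
  have h1 := Exec.discard .C₀ (List.replicate (if sw then 0 else n) .one)
    { reading .start sw false false n 0 (liveWord l).reverse u with
      K := List.replicate k .tick, v := { phase := .start } }
  have h2 := Exec.discard .C₁ (List.replicate (if sw then n else 0) .one)
    { reading .start sw false false n 0 (liveWord l).reverse u with
      K := List.replicate k .tick, v := { phase := .start }, C₀ := [] }
  have h3 := Exec.move (a := .F) (b := .E) (by simp) (liveWord l).reverse
    { U := List.replicate u .tick, K := List.replicate k .tick, v := { phase := .start } }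
  have h4 := Exec.count (List.replicate u .tick) 0 .start
    { E := liveWord l, K := List.replicate k .tick }
  have h5 := Exec.budget (List.replicate k .tick) (binary u).tail 0 0 .start { E := liveWord l }
  rw [List.reverse_reverse, List.length_reverse] at h3
  simp only [List.length_replicate, Nat.zero_add, Nat.add_zero] at h4
  simp only [List.length_replicate, length_tail_binary, Nat.zero_add, Nat.add_zero] at h5
  have h3' := h3.to (s'' := {
      E := liveWord l, U := List.replicate u .tick, K := List.replicate k .tick
      v := { phase := .start } })
    (by simp [St.set, St.get, St.setV, Reg.setC]) le_rfl
  refine (Exec.comp h1 (Exec.comp h2 (Exec.comp h3' (Exec.comp h4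
    (Exec.comp (.op _ _) h5))))).to rfl ?_
  cases sw
  · simp
    omega
  · simp
    omega

theorem length_liveWord_foldl_elimAt {n : ℕ} (bs : List (List Bool)) (l : List Eqn)
    (h : ∀ e ∈ l, e.row.length = n) :
    (liveWord (bs.foldl (fun l b => elimAt l (selected l.length b)) l)).length
      = (liveWord l).length := by
  induction bs generalizing l with
  | nil => rfl
  | cons b bs ih =>
    exact (ih _ (elimAt_length_row h _)).trans (length_liveWord_elimAt h _)

theorem length_guessWord {k m : ℕ} {bs : List (List Bool)} (h : bs.length = k)
    (hbs : ∀ b ∈ bs, b.length = m) : (guessWord bs).length = k * (m + 1) := by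
  subst h
  induction bs with
  | nil => simp [guessWord]
  | cons b bs ih =>
    have := ih fun b hb => hbs b (by simp [hb])
    simp only [guessWord, List.map_cons, List.flatten_cons, List.length_append, List.length_cons,
      List.length_map, List.length_nil, hbs b (by simp)] at this ⊢
    rw [this]
    ring

theorem Exec.to' {p : Prog} {s s' s'' : St} {l l' : List Bool} {t t' : ℕ} (h : Exec p s l t s')
    (hl : l = l') (hs : s' = s'') (ht : t ≤ t') : Exec p s l' t' s'' :=
  hl ▸ hs ▸ h.mono ht

theorem Exec.solve {x : List SysLetter} {n : ℕ} {l : List Eqn} (hx : Presents x n l) (k : ℕ)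
    (bits : List Bool) (hbits : bits.length = k * Nat.log 2 x.length) :
    Exec solve { I := (paramInput x k).map inputSym } bits
      (100 * ((k + 1) * (k + 1)) * (x.length + 1) ^ 2)
      { L := (binary x.length).tail
        v := { phase := .start
               ge := decide ((k : ℤ) ≤ score ((blocks k (Nat.log 2 x.length) bits).foldl
                (fun l b => elimAt l (selected l.length b)) l)) } } := by
  set m := Nat.log 2 x.length with hm
  set bs := blocks k m bits with hbs
  have hrow : ∀ e ∈ l, e.row.length = n := fun e he => (hx.1 e he).length_row
  obtain ⟨sw, hf⟩ := hx.readOp_fold k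
  have h1 := Exec.readInput (x.map sysSym ++ List.replicate k .tick)
  rw [hf] at h1
  have h2 := Exec.prepare l sw n x.length k
  have h3 := Exec.guess k m bits hbits .start
    { E := liveWord l, L := (binary x.length).tail, N := binary k }
  have h4 := Exec.rounds bs l hrow .start { L := (binary x.length).tail, N := binary k }
  set l' := bs.foldl (fun l b => elimAt l (selected l.length b)) l with hl'
  have h5 := Exec.sum l' k .start { L := (binary x.length).tail }
  have h6 := Exec.compare (l'.map Eqn.pos).sum (k + (l'.map Eqn.neg).sum) .start
    { L := (binary x.length).tail }
  rw [map_inputSym_paramInput]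
  refine (Exec.comp h1 (Exec.comp (.op _ _) (Exec.comp (.ite_true rfl h2)
    (Exec.seq h3 (.ite_true rfl (Exec.comp h4 (Exec.comp h5 h6))))))).to' ?_ ?_ ?_
  · simp
  · congr 3
    rw [eq_iff_iff, score_eq]
    omega
  · have hlen : (liveWord l').length = (liveWord l).length := length_liveWord_foldl_elimAt bs l hrow
    have hpos := size_sum_le Eqn.pos (fun e => by unfold Eqn.pos; split <;> omega) l'
    have hneg := size_sum_le Eqn.neg (fun e => by unfold Eqn.neg; split <;> omega) l'
    have hk := size_add_le k (l'.map Eqn.neg).sum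
    have hk' := size_le_self k
    have hg : (guessWord bs).length = k * (m + 1) :=
      length_guessWord (length_blocks _ _ _) fun b hb => length_of_mem_blocks hbits hb
    have hmx : m ≤ x.length := Nat.log_le_self 2 _
    obtain ⟨hw, -⟩ := length_liveWord_le l
    have hxl : x.length = n + 1 + (l.map Eqn.letters).flatten.length := by
      rw [hx.2]
      simp
      omega
    rw [hlen] at hpos hneg ⊢
    rw [hg]
    simp only [List.length_append, List.length_map, List.length_replicate]
    generalize (liveWord l).length = w at *
    generalize x.length = u at *
    have hw' : w ≤ 2 * u := by omega
    have hn : n ≤ u := by omega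
    have hc : 2 * ((l'.map Eqn.pos).sum.size + (k + (l'.map Eqn.neg).sum).size) + 1
        ≤ 2 * (2 * k + 4 * u + 1) + 1 := by omega
    rw [← hm]
    refine le_trans (Nat.add_le_add_left (Nat.add_le_add_left (m := 2 * u + 2 * (2 * u)
      + u * (4 * u + 15) + k * (4 * k + 4 * u + 20) + 6 + 1 + (4 * (k * (u + 1)) + 1 +
      (k * (u + 1) * (10 * (2 * u) + 10) + 1 + (2 * u * (4 * (k + 2 * u + 1) + 25) + 1 +
      (2 * (2 * k + 4 * u + 1) + 1)) + 1))) (by gcongr) _) _) ?_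
    ring_nf
    omega

theorem Exec.solve_of_not_presents {x : List SysLetter} (hx : ¬ ∃ n l, Presents x n l) (k : ℕ) :
    ∃ s : St, accepting s.v = false ∧ Exec LinAA.solve { I := (paramInput x k).map inputSym } []
      (100 * ((k + 1) * (k + 1)) * (x.length + 1) ^ 2) s := by
  set y := x.map sysSym ++ List.replicate k .tick with hy
  have hp : (readOp.fold y {}).v.phase ≠ .start := fun h => hx (exists_presents_of_phase h)
  have hB : readOp.fold y {} = (readOp.fold y {}).set .B [] := by
    have : ∀ (y : List Sym) (s : St), readOp.fold y (s.set .B []) = (readOp.fold y s).set .B [] := by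
      intro y
      induction y with
      | nil => exact fun s => rfl
      | cons a y ih =>
        intro s
        rw [Op.fold_cons, Op.fold_cons, ← ih, St.set_v, ← St.set_setV, Op.run_set]
        simp [readOp, headerOp, rowOp, weightOp, bitOp, badOp, Op.clear, pushC, popC', Op.Avoids]
    exact this y {}
  have h1 := Exec.readInput y
  rw [hB] at h1
  generalize readOp.fold y {} = s at *
  have hw : wellFormed { phase := s.v.phase } = false := by simpa [wellFormed] using hp
  have hg := Exec.popAll_done (k := .B) (p := .ite (fun v => v.c = some .tick)
    (.flip ;; .op (.seq (.push .G fun v => bitSym v.bit) resetOp))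
    (.op (.seq (.push .G fun _ => .sep) resetOp)))
    ((s.set .I []).setV { phase := s.v.phase })
  refine ⟨((s.set .I []).set .B []).setV { phase := s.v.phase }, by simp [accepting, hw], ?_⟩
  rw [map_inputSym_paramInput, ← hy]
  refine (Exec.comp h1 (Exec.comp (.op _ _) (Exec.comp (.ite_false hw (.op _ _))
    (Exec.comp hg (Exec.ite_false
    (s := ((s.set .I []).set .B []).setV { phase := s.v.phase }) hw (.op _ _)))))).to rfl ?_
  simp only [hy, List.length_append, List.length_map, List.length_replicate]
  nlinarith [Nat.zero_le (k * x.length), Nat.zero_le (k * x.length ^ 2),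
    Nat.zero_le (k ^ 2 * x.length), Nat.zero_le (k ^ 2 * x.length ^ 2)]

theorem accepting_solve_iff {x : List SysLetter} {n : ℕ} {l : List Eqn} (hx : Presents x n l)
    (k : ℕ) : (∃ bits : List Bool, bits.length = k * Nat.log 2 x.length ∧
      (k : ℤ) ≤ score ((blocks k (Nat.log 2 x.length) bits).foldl
        (fun l b => elimAt l (selected l.length b)) l)) ↔ ∃ z, k ≤ excess l z := by
  have hL : l.length ≤ 2 ^ Nat.log 2 x.length := by
    have h1 := Nat.lt_pow_succ_log_self (b := 2) (by norm_num) x.length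
    have h2 := (length_liveWord_le l).2
    have h3 : (l.map Eqn.letters).flatten.length ≤ x.length := by
      rw [hx.2]
      simp
      omega
    rw [pow_succ] at h1
    omega
  rw [exists_le_excess_iff hx.1 hL]
  constructor
  · rintro ⟨bits, hbits, h⟩
    exact ⟨_, length_blocks _ _ _, fun b hb => length_of_mem_blocks hbits hb, h⟩
  · rintro ⟨bs, hk, hbs, h⟩
    obtain ⟨bits, hbits, rfl⟩ := exists_blocks_eq hk hbs
    exact ⟨bits, hbits, h⟩

theorem presents_of_mem {x : List SysLetter} {k : ℕ} (h : (x, k) ∈ MaxLinAA) :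
    ∃ n l, Presents x n l := by
  obtain ⟨n, l, hl, hx, -⟩ := (mem_maxLinAA_iff x k).1 h
  exact ⟨n, l, hl, hx⟩

end LinAA

theorem NTM.Bounded.mono {I : Type} {M : NTM I} {u : List I} {T T' S S' : ℕ}
    (h : M.Bounded u T S) (hT : T ≤ T') (hS : S ≤ S') : M.Bounded u T' S' :=
  fun t s d hr => ⟨(h t s d hr).1.trans hT, (h t s d hr).2.trans hS⟩

open LinAA in
theorem mainTheorem6 : InWP MaxLinAA := by
  refine ⟨machine solve accepting, fun k => 101 * ((k + 1) * (k + 1)), (Polynomial.X + 1) ^ 2,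
    ?_, fun x k => ?_⟩
  · have h1 : Primrec fun k : ℕ => k + 1 := Primrec.succ
    exact (Primrec.nat_mul.comp (Primrec.const 101) (Primrec.nat_mul.comp h1 h1)).to_comp
  · have hT : 100 * ((k + 1) * (k + 1)) * (x.length + 1) ^ 2 + 1
        ≤ 101 * ((k + 1) * (k + 1)) * ((Polynomial.X + 1) ^ 2 : Polynomial ℕ).eval x.length := by
      have : 0 < (k + 1) * (k + 1) * (x.length + 1) ^ 2 := by positivity
      simp only [Polynomial.eval_pow, Polynomial.eval_add, Polynomial.eval_X, Polynomial.eval_one]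
      nlinarith
    have key : ∀ {n l}, Presents x n l → _ := fun {n l} hx =>
      machine_bounded_and_accepts_iff (p := solve) (accept := accepting) _
        (fun bits hbits => Exec.solve hx k bits hbits)
    have hacc : ∀ {n l}, Presents x n l →
        ((machine solve accepting).Accepts (paramInput x k) ↔ ∃ z, k ≤ excess l z) := by
      intro n l hx
      rw [(key hx).2, ← accepting_solve_iff hx k]
      simp [accepting, wellFormed]
    by_cases hx : ∃ n l, Presents x n l
    · obtain ⟨n, l, hx⟩ := hx
      refine ⟨(key hx).1.mono hT (Nat.mul_le_mul_right _ (by nlinarith)), fun h => ?_, fun h => ?_⟩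
      · exact (mem_maxLinAA_iff x k).2 ⟨n, l, hx.1, hx.2, (hacc hx).1 h⟩
      · obtain ⟨n', l', hl', hx', hz⟩ := (mem_maxLinAA_iff x k).1 h
        exact (hacc (n := n') (l := l') ⟨hl', hx'⟩).2 hz
    · obtain ⟨s, hs, he⟩ := Exec.solve_of_not_presents hx k
      have h := machine_bounded_and_accepts_iff (N := 0) (accept := accepting) (fun _ => s)
        (fun bits hbits => (List.length_eq_zero_iff.1 hbits).symm ▸ he)
      refine ⟨h.1.mono hT (Nat.zero_le _), fun ha => ?_, fun hm => absurd (presents_of_mem hm) hx⟩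
      obtain ⟨_, _, ha⟩ := h.2.1 ha
      simp [hs] at ha
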